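/- Let $d \ge 0$, let $A \in \mathbb{Q}^{d\times d}$, $x \in \mathbb{Q}^d$, and let $U \subseteq \mathbb{Q}^d$ be a linear subspace of dimension at most one, presented by a basis of rational vectors. Suppose that the complex eigenvalues of $A$ have distinct moduli up to complex conjugate pairs, that is, any two eigenvalues $\lambda, \mu \in \mathbb{C}$ of $A$ with $|\lambda| = |\mu|$ satisfy $\mu = \lambda$ or $\mu = \overline{\lambda}$. Then it is decidable whether there exists an $n \in \mathbb{N} = \{0,1,2,\dots\}$ such that $A^n x \in U$: there is a single algorithm which, given $d$, $A$, $x$ and the basis of $U$ for any such instance, halts and correctly answers whether such an $n$ exists. -/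

import Mathlib

/-- An instance of the Orbit Problem: a rational `d × d` matrix `A`, a rational starting point `x`
and a target subspace of `ℚ^d` presented by a basis. -/
structure OrbitInstance where
  d : ℕ
  A : Matrix (Fin d) (Fin d) ℚ
  x : Fin d → ℚ
  basis : List (Fin d → ℚ)
  linearIndependent : LinearIndependent ℚ basis.get

namespace OrbitInstance

/-- The target subspace `U`. -/
def target (I : OrbitInstance) : Submodule ℚ (Fin I.d → ℚ) :=
  Submodule.span ℚ {v | v ∈ I.basis}

/-- The question of the Orbit Problem: the orbit of `x` under `A` meets the target. -/
def Reaches (I : OrbitInstance) : Prop :=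
  ∃ n : ℕ, (I.A ^ n).mulVec I.x ∈ I.target

/-- A rational number is written down as numerator and denominator in lowest terms. -/
def encodeRat (q : ℚ) : ℤ × ℕ := (q.num, q.den)

/-- A rational vector is written down as the list of its entries. -/
def encodeVec {d : ℕ} (v : Fin d → ℚ) : List (ℤ × ℕ) :=
  List.ofFn fun i => encodeRat (v i)

/-- The finite data that an algorithm reads: the dimension, the rows of the matrix,
the starting point and the basis vectors of the target. -/
abbrev Input : Type :=
  ℕ × List (List (ℤ × ℕ)) × List (ℤ × ℕ) × List (List (ℤ × ℕ))

/-- The input that presents an instance. -/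
def encode (I : OrbitInstance) : Input :=
  (I.d, List.ofFn (fun i => encodeVec (I.A i)), encodeVec I.x, I.basis.map encodeVec)

/-- The Orbit Problem is decidable on a class of instances: one algorithm (a partial recursive
function on the inputs) halts on every instance of the class, of whatever dimension, and tells
correctly whether the target is reached. -/
def DecidableOn (C : Set OrbitInstance) : Prop :=
  ∃ f : Input →. Bool, Partrec f ∧
    ∀ I ∈ C, ∃ b ∈ f I.encode, (b = true ↔ I.Reaches)

end OrbitInstance

/-- The complex eigenvalues of `A` have distinct moduli up to complex conjugate pairs. -/
def Matrix.HasDistinctModuli {d : ℕ} (A : Matrix (Fin d) (Fin d) ℚ) : Prop :=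
  ∀ z w : ℂ,
    Module.End.HasEigenvalue (Matrix.toLin' (A.map (algebraMap ℚ ℂ))) z →
    Module.End.HasEigenvalue (Matrix.toLin' (A.map (algebraMap ℚ ℂ))) w →
    ‖z‖ = ‖w‖ → w = z ∨ w = starRingEnd ℂ z

/-! It suffices to bound computably some time at which the line is met, if it is met at all;
finitely many exact tests then decide. If some `A ^ n x` is zero, so is `A ^ d x`. Otherwise clear
denominators, so that `A`, `x` and the spanning vector `u` are integral, and suppose `A ^ n x = c u`
with `c ≠ 0`.

Over a splitting field `K` of the characteristic polynomial, take a minimal multiset `s` of its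
roots for which the product of the `A - r` kills `x`. Omitting one factor `A - r` turns `x` into an
eigenvector `w ≠ 0` and `u` into some `w'`, with `r ^ n w = c w'`. All entries are algebraic
integers whose conjugates are bounded in terms of the input, so the nonzero ones cannot be small
under any embedding (`one_le_norm_mul_pow`). Eliminating `c` between two such equations leaves these
cases.

Two nonzero roots of different modulus: their ratio to the power `n` is bounded, and the gap between
the moduli is bounded below (`le_of_norm_lt_norm`). A repeated nonzero root: a Jordan block makes
`n` itself a quotient of bounded quantities (`le_of_jordan_block`). Otherwise the nonzero roots are
simple and of one modulus, so by the hypothesis on moduli there are at most two, `r` and its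
conjugate `t`. As `s` is stable under Galois, `r / t + t / r` is rational. If it is not an integer,
the denominators of `(r / t) ^ n + (t / r) ^ n` grow while the equations keep them bounded
(`le_of_nonintegral_trace`). If it is an integer, it is at most 2 in absolute value, so `(r / t) ^
12 = 1` and the orbit is projectively periodic; with at most one nonzero root it is periodic for
simpler reasons. -/

open Polynomial NumberField Matrix

/-! ### Algebraic integers with bounded conjugates. -/

section House
variable {K : Type*} [Field K] [NumberField K]

/-- `α` is an algebraic integer all of whose conjugates have modulus at most `C`. -/
def IsHouseBounded (C : ℝ) (α : K) : Prop := IsIntegral ℤ α ∧ house α ≤ C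

namespace IsHouseBounded
variable {C D : ℝ} {α β : K}

lemma nonneg (h : IsHouseBounded C α) : 0 ≤ C := (house_nonneg α).trans h.2

lemma mono (h : IsHouseBounded C α) (hCD : C ≤ D) : IsHouseBounded D α := ⟨h.1, h.2.trans hCD⟩

lemma mul (h : IsHouseBounded C α) (h' : IsHouseBounded D β) : IsHouseBounded (C * D) (α * β) :=
  ⟨h.1.mul h'.1, (house_mul_le α β).trans
    (mul_le_mul h.2 h'.2 (house_nonneg β) h.nonneg)⟩

lemma neg (h : IsHouseBounded C α) : IsHouseBounded C (-α) :=
  ⟨h.1.neg, by simpa [house] using h.2⟩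

lemma add (h : IsHouseBounded C α) (h' : IsHouseBounded D β) : IsHouseBounded (C + D) (α + β) :=
  ⟨h.1.add h'.1, (house_add_le α β).trans (add_le_add h.2 h'.2)⟩

lemma sub (h : IsHouseBounded C α) (h' : IsHouseBounded D β) : IsHouseBounded (C + D) (α - β) := by
  rw [sub_eq_add_neg]; exact h.add h'.neg

lemma intCast (a : ℤ) : IsHouseBounded (|a| : ℝ) (a : K) :=
  ⟨isIntegral_algebraMap (R := ℤ) (x := a), by simp⟩

lemma norm_le (h : IsHouseBounded C α) (φ : K →+* ℂ) : ‖φ α‖ ≤ C :=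
  (norm_embedding_le_house α φ).trans h.2

lemma sum {ι : Type*} (s : Finset ι) {c : ι → ℝ} {f : ι → K}
    (h : ∀ i ∈ s, IsHouseBounded (c i) (f i)) :
    IsHouseBounded (∑ i ∈ s, c i) (∑ i ∈ s, f i) :=
  ⟨IsIntegral.sum _ fun i hi => (h i hi).1,
    (house_sum_le_sum_house s f).trans (Finset.sum_le_sum fun i hi => (h i hi).2)⟩

/-- Liouville's inequality: the norm is a nonzero integer, and every conjugate but one contributes
at most `C` to it. -/
lemma one_le_norm_mul_pow (h : IsHouseBounded C α) (hα : α ≠ 0) (hC : 1 ≤ C) {F : ℕ}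
    (hF : Module.finrank ℚ K ≤ F) (φ : K →+* ℂ) : 1 ≤ ‖φ α‖ * C ^ F := by
  have h1 : (1 : ℝ) ≤ ‖Algebra.norm ℚ α‖ := by
    have hi : IsIntegral ℤ (Algebra.norm ℚ α) := Algebra.isIntegral_norm ℚ h.1
    obtain ⟨m, hm⟩ := IsIntegrallyClosed.isIntegral_iff.1 hi
    have hm0 : m ≠ 0 := by
      rintro rfl
      exact hα (Algebra.norm_eq_zero_iff (R := ℚ).1 (by rw [← hm, map_zero]))
    rw [← hm]
    have : (1 : ℝ) ≤ |(m : ℝ)| := by exact_mod_cast Int.one_le_abs hm0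
    simpa [← Rat.norm_cast_real] using this
  refine h1.trans ((norm_norm_le_norm_mul_house_pow α φ).trans ?_)
  gcongr
  calc house α ^ (Module.finrank ℚ K - 1) ≤ C ^ (Module.finrank ℚ K - 1) := by
        gcongr
        · exact house_nonneg α
        · exact h.2
    _ ≤ C ^ F := pow_le_pow_right₀ hC (by omega)

end IsHouseBounded
end House

/-! ### Products of linear factors in a matrix, and minimal annihilators of a vector. -/

section RootProduct
variable {K : Type*} [Field K] {d : ℕ}

/-- The matrix `∏ (A - r)`, the product being over the elements `r` of `s`. -/
noncomputable def Matrix.rootProd (A : Matrix (Fin d) (Fin d) K) (s : Multiset K) :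
    Matrix (Fin d) (Fin d) K :=
  aeval A (s.map fun r => X - C r).prod

namespace Matrix
variable (A : Matrix (Fin d) (Fin d) K)

@[simp] lemma rootProd_zero : A.rootProd 0 = 1 := by simp [rootProd]

lemma rootProd_add (s t : Multiset K) : A.rootProd (s + t) = A.rootProd s * A.rootProd t := by
  simp [rootProd]

lemma rootProd_singleton (r : K) : A.rootProd {r} = A - r • 1 := by
  simp [rootProd, Algebra.algebraMap_eq_smul_one]

lemma rootProd_cons (r : K) (s : Multiset K) :
    A.rootProd (r ::ₘ s) = (A - r • 1) * A.rootProd s := by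
  rw [← Multiset.singleton_add, rootProd_add, rootProd_singleton]

lemma rootProd_replicate_zero (k : ℕ) : A.rootProd (Multiset.replicate k 0) = A ^ k := by
  simp [rootProd]

lemma rootProd_mul_pow (s : Multiset K) (n : ℕ) :
    A.rootProd s * A ^ n = A ^ n * A.rootProd s := by
  rw [← rootProd_replicate_zero, ← rootProd_add, ← rootProd_add, add_comm]

lemma rootProd_mulVec_pow_mulVec (s : Multiset K) (n : ℕ) (v : Fin d → K) :
    A.rootProd s *ᵥ (A ^ n *ᵥ v) = A ^ n *ᵥ (A.rootProd s *ᵥ v) := by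
  simp only [mulVec_mulVec, rootProd_mul_pow]

lemma rootProd_mulVec_comm (s t : Multiset K) (v : Fin d → K) :
    A.rootProd s *ᵥ (A.rootProd t *ᵥ v) = A.rootProd t *ᵥ (A.rootProd s *ᵥ v) := by
  simp only [mulVec_mulVec, ← rootProd_add, add_comm]

variable {A}

lemma pow_mulVec_of_eigen {v : Fin d → K} {r : K} (h : A *ᵥ v = r • v) (n : ℕ) :
    A ^ n *ᵥ v = r ^ n • v := by
  induction n with
  | zero => simp
  | succ n ih => rw [pow_succ', ← mulVec_mulVec, ih, mulVec_smul, h, smul_smul, pow_succ]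

lemma rootProd_mulVec_of_eigen {v : Fin d → K} {r : K} (h : A *ᵥ v = r • v) (s : Multiset K) :
    A.rootProd s *ᵥ v = (s.map (r - ·)).prod • v := by
  induction s using Multiset.induction with
  | empty => simp
  | cons a s ih =>
    rw [rootProd_cons, ← mulVec_mulVec, ih, mulVec_smul, sub_mulVec, smul_mulVec, one_mulVec, h,
      ← sub_smul, smul_smul, Multiset.map_cons, Multiset.prod_cons, mul_comm]

/-- If `A ^ p` acts on `A ^ k x` as a nonzero scalar, the orbit of `x` is projectively periodic. -/
lemma exists_lt_pow_mulVec_eq_smul {x : Fin d → K} {k p : ℕ} {ρ : K} (hp : 0 < p) (hρ : ρ ≠ 0)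
    (h : A ^ p *ᵥ (A ^ k *ᵥ x) = ρ • (A ^ k *ᵥ x)) (n : ℕ) :
    ∃ m < k + p, ∃ a : K, a ≠ 0 ∧ A ^ n *ᵥ x = a • (A ^ m *ᵥ x) := by
  rcases lt_or_ge n k with hn | hn
  · exact ⟨n, by omega, 1, one_ne_zero, by simp⟩
  · refine ⟨k + (n - k) % p, by have := Nat.mod_lt (n - k) hp; omega, ρ ^ ((n - k) / p),
      pow_ne_zero _ hρ, ?_⟩
    have e : n = (n - k) % p + (p * ((n - k) / p) + k) := by
      have := Nat.mod_add_div (n - k) p; omega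
    conv_lhs => rw [e, pow_add, pow_add, pow_mul, ← mulVec_mulVec, ← mulVec_mulVec,
      pow_mulVec_of_eigen h, mulVec_smul, mulVec_mulVec, ← pow_add, add_comm _ k]

/-- A vector is annihilated by the product of `A - r` over a minimal multiset of roots of the
characteristic polynomial. -/
lemma exists_minimal_rootProd_mulVec_eq_zero [DecidableEq K] (hA : A.charpoly.Splits) (x : Fin d → K) :
    ∃ s ≤ A.charpoly.roots, A.rootProd s *ᵥ x = 0 ∧
      ∀ r ∈ s, A.rootProd (s.erase r) *ᵥ x ≠ 0 := by
  have h0 : A.rootProd A.charpoly.roots *ᵥ x = 0 := by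
    have : A.rootProd A.charpoly.roots = 0 := by
      rw [rootProd, ← hA.eq_prod_roots_of_monic A.charpoly_monic, aeval_self_charpoly]
    rw [this, zero_mulVec]
  obtain ⟨s, ⟨hs, hs0⟩, hmin⟩ := exists_minimal_of_wellFoundedLT
    (fun s : Multiset K => s ≤ A.charpoly.roots ∧ A.rootProd s *ᵥ x = 0) ⟨_, le_rfl, h0⟩
  refine ⟨s, hs, hs0, fun r hr h => ?_⟩
  have h1 := hmin ⟨(s.erase_le r).trans hs, h⟩ (s.erase_le r)
  have h2 := Multiset.card_erase_lt_of_mem hr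
  exact absurd (Multiset.card_le_card h1) (by omega)

lemma rootProd_erase_eigen [DecidableEq K] {s : Multiset K} {x : Fin d → K} {r : K} (hr : r ∈ s)
    (h : A.rootProd s *ᵥ x = 0) :
    A *ᵥ (A.rootProd (s.erase r) *ᵥ x) = r • (A.rootProd (s.erase r) *ᵥ x) := by
  rw [← Multiset.cons_erase hr, rootProd_cons, ← mulVec_mulVec, sub_mulVec, smul_mulVec,
    one_mulVec, sub_eq_zero] at h
  exact h

end Matrix
end RootProduct

/-! ### Height bounds for eigenvalues and eigenvectors, and separation of moduli. -/

section Bounds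
variable {K : Type*} [Field K] [NumberField K] {d : ℕ} {A : Matrix (Fin d) (Fin d) ℤ} {B : ℕ}

lemma Matrix.norm_le_of_eigen (hA : ∀ i, ∑ j, |A i j| ≤ B) {v : Fin d → ℂ} (hv : v ≠ 0) {z : ℂ}
    (h : A.map (Int.cast : ℤ → ℂ) *ᵥ v = z • v) : ‖z‖ ≤ B := by
  obtain ⟨i₀, hi₀⟩ := Function.ne_iff.1 hv
  -- Compare both sides of the eigenvalue equation at an entry of largest modulus.
  obtain ⟨i, -, hi⟩ := Finset.exists_max_image Finset.univ (fun i => ‖v i‖) ⟨i₀, Finset.mem_univ _⟩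
  have hpos : 0 < ‖v i‖ := (norm_pos_iff.2 hi₀).trans_le (hi i₀ (Finset.mem_univ _))
  refine le_of_mul_le_mul_right ?_ hpos
  have hvi := congrFun h i
  simp only [Matrix.mulVec, dotProduct, Matrix.map_apply, Pi.smul_apply, smul_eq_mul] at hvi
  rw [← norm_mul, ← hvi]
  calc ‖∑ j, (A i j : ℂ) * v j‖ ≤ ∑ j, (|A i j| : ℝ) * ‖v i‖ := by
        refine norm_sum_le_of_le _ fun j _ => ?_
        rw [norm_mul, Complex.norm_intCast]
        exact mul_le_mul_of_nonneg_left (hi j (Finset.mem_univ _)) (abs_nonneg _)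
    _ = (∑ j, (|A i j| : ℝ)) * ‖v i‖ := by rw [Finset.sum_mul]
    _ ≤ B * ‖v i‖ := by
        gcongr
        exact_mod_cast hA i

lemma Matrix.isHouseBounded_of_mem_roots (hA : ∀ i, ∑ j, |A i j| ≤ B) {r : K}
    (hr : r ∈ (A.map (Int.cast : ℤ → K)).charpoly.roots) : IsHouseBounded (B : ℝ) r := by
  have hroot : (A.map (Int.cast : ℤ → K)).charpoly.IsRoot r := isRoot_of_mem_roots hr
  have hmap : (A.map (Int.cast : ℤ → K)).charpoly = A.charpoly.map (Int.castRingHom K) :=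
    A.charpoly_map (Int.castRingHom K)
  refine ⟨⟨A.charpoly, A.charpoly_monic, ?_⟩, ?_⟩
  · rw [hmap, IsRoot.def, eval_map] at hroot
    simpa using hroot
  · rw [house_eq_sup', ← NNReal.coe_natCast, NNReal.coe_le_coe]
    refine Finset.sup'_le _ _ fun σ _ => ?_
    rw [← NNReal.coe_le_coe, coe_nnnorm, NNReal.coe_natCast]
    have hσ : (A.map (Int.cast : ℤ → ℂ)).charpoly.IsRoot (σ r) := by
      have e : (A.map (Int.cast : ℤ → ℂ)).charpoly
          = (A.map (Int.cast : ℤ → K)).charpoly.map σ := by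
        rw [← charpoly_map]; congr 1; ext i j; simp
      rw [e]; exact hroot.map
    have hev : Module.End.HasEigenvalue (toLin' (A.map (Int.cast : ℤ → ℂ))) (σ r) := by
      rw [Module.End.hasEigenvalue_iff_isRoot_charpoly, charpoly_toLin']
      exact hσ
    obtain ⟨v, hv⟩ := hev.exists_hasEigenvector
    exact norm_le_of_eigen hA hv.2 (by simpa using hv.apply_eq_smul)

/-- Each factor `A - r` costs at most `2 * B`: the row sums of `A` and the root `r` contribute `B`
each. -/
lemma Matrix.isHouseBounded_rootProd_mulVec (hA : ∀ i, ∑ j, |A i j| ≤ B) {x : Fin d → ℤ}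
    (hx : ∀ i, |x i| ≤ B) {s : Multiset K}
    (hs : ∀ r ∈ s, r ∈ (A.map (Int.cast : ℤ → K)).charpoly.roots) (i : Fin d) :
    IsHouseBounded ((2 * B : ℝ) ^ s.card * B)
      (((A.map (Int.cast : ℤ → K)).rootProd s *ᵥ (fun i => (x i : K))) i) := by
  induction s using Multiset.induction generalizing i with
  | empty =>
    have hxi : (|x i| : ℝ) ≤ B := by exact_mod_cast hx i
    simpa using (IsHouseBounded.intCast (K := K) (x i)).mono hxi
  | cons r s ih =>
    have ih' := fun i => ih (fun a ha => hs a (Multiset.mem_cons_of_mem ha)) i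
    rw [rootProd_cons, ← mulVec_mulVec, sub_mulVec, smul_mulVec, one_mulVec]
    have h1 := (isHouseBounded_of_mem_roots hA (hs r (Multiset.mem_cons_self r s))).mul (ih' i)
    have h2 := IsHouseBounded.sum Finset.univ fun j _ =>
      (IsHouseBounded.intCast (K := K) (A i j)).mul (ih' j)
    refine IsHouseBounded.mono (h2.sub h1) ?_
    rw [← Finset.sum_mul, Multiset.card_cons, pow_succ]
    have : (∑ j, (|A i j| : ℝ)) ≤ B := by exact_mod_cast hA i
    have h3 : (∑ j, (|A i j| : ℝ)) * ((2 * B : ℝ) ^ s.card * B) ≤ B * ((2 * B : ℝ) ^ s.card * B) := by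
      gcongr
    linarith

/-- Roots of the characteristic polynomial of different moduli have well separated moduli. -/
lemma Matrix.one_le_norm_sq_sub_norm_sq_mul (hB : 1 ≤ B) (hA : ∀ i, ∑ j, |A i j| ≤ B)
    (hsp : (A.map (Int.cast : ℤ → K)).charpoly.Splits) (φ : K →+* ℂ) {F : ℕ}
    (hF : Module.finrank ℚ K ≤ F) {r t : K}
    (hr : r ∈ (A.map (Int.cast : ℤ → K)).charpoly.roots)
    (ht : t ∈ (A.map (Int.cast : ℤ → K)).charpoly.roots) (hrt : ‖φ t‖ < ‖φ r‖) :
    1 ≤ (‖φ r‖ ^ 2 - ‖φ t‖ ^ 2) * (2 * (B : ℝ) ^ 2) ^ F := by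
  -- The complex conjugate of a root is again a root, hence the image of an element of `K`. So the
  -- difference of squared moduli is the image of `r * r' - t * t'`, to which Liouville's inequality
  -- applies.
  have hconj : ∀ r ∈ (A.map (Int.cast : ℤ → K)).charpoly.roots,
      ∃ r' ∈ (A.map (Int.cast : ℤ → K)).charpoly.roots, φ r' = starRingEnd ℂ (φ r) := by
    intro r hr
    have e : (A.map (Int.cast : ℤ → ℂ)).charpoly = (A.map (Int.cast : ℤ → K)).charpoly.map φ := by
      rw [← charpoly_map]; congr 1; ext i j; simp
    have e' : (A.map (Int.cast : ℤ → ℂ)).charpoly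
        = ((A.map (Int.cast : ℤ → K)).charpoly.map φ).map (starRingEnd ℂ) := by
      rw [← charpoly_map, ← charpoly_map]; congr 1; ext i j; simp
    have h1 : starRingEnd ℂ (φ r) ∈ (A.map (Int.cast : ℤ → ℂ)).charpoly.roots := by
      rw [mem_roots (charpoly_monic _).ne_zero, e']
      exact (isRoot_of_mem_roots hr).map.map
    rw [e, hsp.roots_map, Multiset.mem_map] at h1
    exact h1
  obtain ⟨r', hr', hr'e⟩ := hconj r hr
  obtain ⟨t', ht', ht'e⟩ := hconj t ht
  have hb : ∀ {r : K}, r ∈ (A.map (Int.cast : ℤ → K)).charpoly.roots → IsHouseBounded (B : ℝ) r :=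
    isHouseBounded_of_mem_roots hA
  have hbd := ((hb hr).mul (hb hr')).sub ((hb ht).mul (hb ht'))
  have hφ : φ (r * r' - t * t') = ((‖φ r‖ ^ 2 - ‖φ t‖ ^ 2 : ℝ) : ℂ) := by
    rw [map_sub, map_mul, map_mul, hr'e, ht'e, Complex.mul_conj', Complex.mul_conj']
    push_cast; ring
  have hpos : 0 < ‖φ r‖ ^ 2 - ‖φ t‖ ^ 2 := by
    have := norm_nonneg (φ t); nlinarith
  have hne : r * r' - t * t' ≠ 0 := by
    intro h0
    rw [h0, map_zero] at hφ
    exact hpos.ne' (by exact_mod_cast hφ.symm)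
  have hB' : (1 : ℝ) ≤ B := by exact_mod_cast hB
  have := (hbd.mono (D := 2 * (B : ℝ) ^ 2) (by nlinarith)).one_le_norm_mul_pow hne (by nlinarith)
    hF φ
  rwa [hφ, Complex.norm_real, Real.norm_of_nonneg hpos.le] at this

/-- The gap gives `(L / M) ^ 2 ≥ 1 + ε` with `ε = 1 / (G * b ^ 2)`; Bernoulli's inequality then
replaces logarithms. -/
lemma le_of_pow_le_pow_mul {L M G D : ℝ} {b : ℝ} (hM : 0 < M) (hMb : M ≤ b) (hG : 0 ≤ G)
    (hgap : 1 ≤ (L ^ 2 - M ^ 2) * G) (hL : 0 ≤ L) {n : ℕ}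
    (h : L ^ n ≤ M ^ n * D) : (n : ℝ) ≤ G * b ^ 2 * D ^ 2 := by
  have hG0 : 0 < G := by
    rcases hG.eq_or_lt with h0 | h0
    · rw [← h0] at hgap; linarith
    · exact h0
  have hb : 0 < b := hM.trans_le hMb
  set ε : ℝ := 1 / (G * b ^ 2) with hε
  have hε0 : 0 < ε := by positivity
  have h1 : M ^ 2 * (1 + ε) ≤ L ^ 2 := by
    have h2 : M ^ 2 * ε ≤ 1 / G := by
      rw [hε, mul_one_div, div_le_div_iff₀ (by positivity) hG0]
      have : M ^ 2 ≤ b ^ 2 := by gcongr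
      nlinarith
    have h3 : 1 / G ≤ L ^ 2 - M ^ 2 := by rwa [div_le_iff₀ hG0]
    linarith
  have h2 : (M ^ 2) ^ n * (1 + ε) ^ n ≤ (M ^ 2) ^ n * D ^ 2 := by
    calc (M ^ 2) ^ n * (1 + ε) ^ n = (M ^ 2 * (1 + ε)) ^ n := (mul_pow _ _ _).symm
      _ ≤ (L ^ 2) ^ n := by gcongr
      _ = (L ^ n) ^ 2 := by rw [← pow_mul, ← pow_mul, mul_comm]
      _ ≤ (M ^ n * D) ^ 2 := by gcongr
      _ = (M ^ 2) ^ n * D ^ 2 := by rw [mul_pow, ← pow_mul, ← pow_mul, mul_comm n]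
  have h3 := le_of_mul_le_mul_left h2 (by positivity)
  have h4 := one_add_mul_le_pow (a := ε) (by linarith) n
  have h5 : n * ε ≤ D ^ 2 := by linarith
  rw [hε, mul_one_div, div_le_iff₀ (by positivity)] at h5
  linarith

end Bounds

/-! ### Bounds on `n` in the three nonperiodic cases. -/

section Cases
variable {K : Type*} [Field K] [NumberField K] {C : ℝ} {r t c : K}

lemma le_of_norm_lt_norm (hC : 1 ≤ C) (φ : K →+* ℂ) {F : ℕ} (hF : Module.finrank ℚ K ≤ F)
    {a a' b b' : K} (ha : IsHouseBounded C a) (ha' : IsHouseBounded C a')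
    (hb : IsHouseBounded C b) (hb' : IsHouseBounded C b') (ha0 : a ≠ 0) (hb0 : b ≠ 0)
    (ht : t ≠ 0) (hc : c ≠ 0) {n : ℕ} (h1 : r ^ n * a = c * a') (h2 : t ^ n * b = c * b')
    {G β : ℝ} (hβ : ‖φ t‖ ≤ β) (hG : 0 ≤ G) (hgap : 1 ≤ (‖φ r‖ ^ 2 - ‖φ t‖ ^ 2) * G) :
    (n : ℝ) ≤ G * β ^ 2 * (C ^ 2 * (C ^ 2) ^ F) ^ 2 := by
  have hb'0 : b' ≠ 0 := by
    rintro rfl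
    rw [mul_zero] at h2
    exact mul_ne_zero (pow_ne_zero n ht) hb0 h2
  have h3 : r ^ n * (a * b') = t ^ n * (b * a') :=
    mul_left_cancel₀ hc (by linear_combination c * b' * h1 - c * a' * h2)
  have hlow := ((ha.mul hb').mono (D := C ^ 2) (by rw [sq])).one_le_norm_mul_pow
    (mul_ne_zero ha0 hb'0) (one_le_pow₀ hC) hF φ
  have hup := ((hb.mul ha').mono (D := C ^ 2) (by rw [sq])).norm_le φ
  have h4 : ‖φ r‖ ^ n * ‖φ (a * b')‖ = ‖φ t‖ ^ n * ‖φ (b * a')‖ := by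
    rw [← norm_pow, ← norm_mul, ← map_pow, ← map_mul, h3, map_mul, norm_mul, map_pow, norm_pow]
  refine le_of_pow_le_pow_mul (norm_pos_iff.2 ((map_ne_zero φ).2 ht)) hβ hG hgap (norm_nonneg _) ?_
  calc ‖φ r‖ ^ n ≤ ‖φ r‖ ^ n * (‖φ (a * b')‖ * (C ^ 2) ^ F) :=
        le_mul_of_one_le_right (by positivity) hlow
    _ = ‖φ t‖ ^ n * ‖φ (b * a')‖ * (C ^ 2) ^ F := by rw [← mul_assoc, h4]
    _ ≤ ‖φ t‖ ^ n * C ^ 2 * (C ^ 2) ^ F := by gcongr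
    _ = _ := by ring

/-- Here `(A - r) y = w` and `w` is an eigenvector, so `A ^ n y = r ^ n y + n r ^ (n - 1) w`; `h2`
is a coordinate of this, multiplied by `r` to avoid the exponent `n - 1`. -/
lemma le_of_jordan_block (hC : 1 ≤ C) (φ : K →+* ℂ) {F : ℕ} (hF : Module.finrank ℚ K ≤ F)
    {y y' w w' : K} (hy : IsHouseBounded C y) (hy' : IsHouseBounded C y')
    (hw : IsHouseBounded C w) (hw' : IsHouseBounded C w') (hw0 : w ≠ 0)
    (hr : r ≠ 0) {n : ℕ} (h1 : r ^ n * w = c * w')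
    (h2 : r ^ n * (r * y + n * w) = r * (c * y')) {β : ℝ} (hβ : ‖φ r‖ ≤ β) :
    (n : ℝ) ≤ 2 * β * (C ^ 2 * (C ^ 2) ^ F) := by
  have hw'0 : w' ≠ 0 := by
    rintro rfl
    rw [mul_zero] at h1
    exact mul_ne_zero (pow_ne_zero n hr) hw0 h1
  have h3 : (n : K) * (w * w') = r * (y' * w - w' * y) := by
    refine mul_left_cancel₀ (pow_ne_zero n hr) ?_
    linear_combination w' * h2 - r * y' * h1
  have hlow := ((hw.mul hw').mono (D := C ^ 2) (by rw [sq])).one_le_norm_mul_pow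
    (mul_ne_zero hw0 hw'0) (one_le_pow₀ hC) hF φ
  have hup := (((hy'.mul hw).sub (hw'.mul hy)).mono (D := 2 * C ^ 2) (by linarith)).norm_le φ
  have h4 : (n : ℝ) * ‖φ (w * w')‖ = ‖φ r‖ * ‖φ (y' * w - w' * y)‖ := by
    have := congrArg (fun z => ‖φ z‖) h3
    simpa only [map_mul φ (n : K), map_mul φ r, norm_mul, map_natCast, Complex.norm_natCast] using this
  have hβ0 : 0 ≤ β := (norm_nonneg _).trans hβ
  calc (n : ℝ) ≤ n * (‖φ (w * w')‖ * (C ^ 2) ^ F) := le_mul_of_one_le_right (by positivity) hlow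
    _ = ‖φ r‖ * ‖φ (y' * w - w' * y)‖ * (C ^ 2) ^ F := by rw [← mul_assoc, h4]
    _ ≤ β * (2 * C ^ 2) * (C ^ 2) ^ F := by gcongr
    _ = _ := by ring

/-- The powers of a number with nonintegral rational trace have large denominators. -/
lemma exists_intCast_eq_pow_mul {F : Type*} [Field F] {g : F} (hg : g ≠ 0) {p q : ℤ}
    (hq : (q : F) ≠ 0) (hpq : IsCoprime p q) (h : g + g⁻¹ = p / q) (n : ℕ) :
    ∃ e : ℤ, IsCoprime e q ∧ (e : F) = q ^ (n + 1) * (g ^ (n + 1) + (g⁻¹) ^ (n + 1)) := by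
  -- The scaled power sums satisfy the recurrence `e'' = p * e' - q ^ 2 * e`, so two consecutive
  -- terms are carried; modulo `q` the new term is `p * e'`, which keeps it coprime to `q`.
  suffices H : ∀ n : ℕ, ∃ e e' : ℤ, IsCoprime e q ∧ IsCoprime e' q ∧
      (e : F) = q ^ (n + 1) * (g ^ (n + 1) + (g⁻¹) ^ (n + 1)) ∧
      (e' : F) = q ^ (n + 2) * (g ^ (n + 2) + (g⁻¹) ^ (n + 2)) by
    obtain ⟨e, -, he, -, he', -⟩ := H n
    exact ⟨e, he, he'⟩
  have h' : (q : F) * (g + g⁻¹) = p := by rw [h]; field_simp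
  have hgg : g * g⁻¹ = 1 := mul_inv_cancel₀ hg
  intro n
  induction n with
  | zero =>
    refine ⟨p, p ^ 2 - 2 * q ^ 2, hpq, ?_, by linear_combination -h', ?_⟩
    · rw [show p ^ 2 - 2 * q ^ 2 = p ^ 2 + q * (-2 * q) by ring]
      exact (hpq.pow_left (m := 2)).add_mul_left_left (-2 * q)
    · push_cast
      rw [← h']
      linear_combination 2 * (q : F) ^ 2 * hgg
  | succ n ih =>
    obtain ⟨e, e', h1, h2, h3, h4⟩ := ih
    refine ⟨e', p * e' - q ^ 2 * e, h2, ?_, h4, ?_⟩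
    · rw [show p * e' - q ^ 2 * e = p * e' + q * (-q * e) by ring]
      exact (hpq.mul_left h2).add_mul_left_left (-q * e)
    · push_cast
      rw [h3, h4, ← h']
      linear_combination (q : F) ^ (n + 3) * (g ^ (n + 1) + (g⁻¹) ^ (n + 1)) * hgg

lemma le_of_nonintegral_trace (hC : 1 ≤ C)
    {a a' b b' : K} (ha : IsHouseBounded C a) (ha' : IsHouseBounded C a')
    (hb : IsHouseBounded C b) (hb' : IsHouseBounded C b') (ha0 : a ≠ 0) (hb0 : b ≠ 0)
    (hr : r ≠ 0) (ht : t ≠ 0) (hc : c ≠ 0) {n : ℕ} (h1 : r ^ n * a = c * a')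
    (h2 : t ^ n * b = c * b') {p : ℤ} {q : ℕ} (hq : 2 ≤ q) (hpq : IsCoprime p (q : ℤ))
    (h : r / t + t / r = p / q) : (n : ℝ) ≤ C ^ 4 := by
  obtain _ | n := n
  · rw [Nat.cast_zero]; positivity
  set n' := n + 1 with hn'
  have hz : ∀ {r a a' : K}, r ≠ 0 → a ≠ 0 → r ^ n' * a = c * a' → a' ≠ 0 := by
    rintro r a a' hr ha0 h1 rfl
    rw [mul_zero] at h1
    exact mul_ne_zero (pow_ne_zero n' hr) ha0 h1
  have ha'0 := hz hr ha0 h1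
  have hb'0 := hz ht hb0 h2
  have hqK : ((q : ℤ) : K) ≠ 0 := by
    have : q ≠ 0 := by omega
    exact_mod_cast this
  obtain ⟨e, he, heq⟩ := exists_intCast_eq_pow_mul (g := r / t) (div_ne_zero hr ht) hqK hpq
    (by rw [inv_div, h]; push_cast; rfl) n
  have hg : (r / t) ^ n' * (a * b') = a' * b := by
    rw [div_pow]
    field_simp
    exact mul_left_cancel₀ hc (by linear_combination c * b' * h1 - c * a' * h2)
  have hg' : ((r / t)⁻¹) ^ n' * (a' * b) = a * b' := by
    rw [← hg, ← mul_assoc, ← mul_pow, inv_mul_cancel₀ (div_ne_zero hr ht), one_pow, one_mul]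
  have key : (a * b') * (a' * b) * e = (q : K) ^ n' * ((a' * b) ^ 2 + (a * b') ^ 2) := by
    rw [heq]
    push_cast
    linear_combination (q : K) ^ n' * (a' * b * hg + a * b' * hg')
  -- By `key`, `q ^ n'` divides `(a * b') * (a' * b) * e`, and `e` is coprime to it. Bézout makes
  -- the quotient of `(a * b') * (a' * b)` by `q ^ n'` an explicit algebraic integer `η`; being
  -- nonzero it has house at least 1.
  obtain ⟨α, β, hαβ⟩ := (he.pow_right (n := n'))
  have hαβ' : (α : K) * e + β * (q : K) ^ n' = 1 := by
    have := congrArg (Int.cast : ℤ → K) hαβ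
    push_cast at this
    exact this
  set η : K := α * ((a' * b) ^ 2 + (a * b') ^ 2) + β * ((a * b') * (a' * b)) with hη
  have hηz : ((q ^ n' : ℕ) : K) * η = (a * b') * (a' * b) := by
    push_cast
    rw [hη]
    linear_combination -(α : K) * key + (a * b') * (a' * b) * hαβ'
  have hint : IsIntegral ℤ η := by
    have hi : ∀ m : ℤ, IsIntegral ℤ (m : K) := fun m => (IsHouseBounded.intCast m).1
    exact ((hi α).mul (((ha'.mul hb).1.pow 2).add ((ha.mul hb').1.pow 2))).add
      ((hi β).mul ((ha.mul hb').mul (ha'.mul hb)).1)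
  have hη0 : η ≠ 0 := by
    rintro h0
    rw [h0, mul_zero] at hηz
    exact mul_ne_zero (mul_ne_zero ha0 hb'0) (mul_ne_zero ha'0 hb0) hηz.symm
  have hle : ((q ^ n' : ℕ) : ℝ) * house η ≤ C ^ 4 := by
    rw [← house_nat_mul, hηz]
    refine ((ha.mul hb').mul (ha'.mul hb)).2.trans (le_of_eq (by ring))
  have h5 : n' ≤ q ^ n' := (Nat.lt_pow_self (by omega)).le
  calc (n' : ℝ) ≤ ((q ^ n' : ℕ) : ℝ) := by exact_mod_cast h5
    _ ≤ ((q ^ n' : ℕ) : ℝ) * house η :=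
        le_mul_of_one_le_right (by positivity) (one_le_house_of_isIntegral hint hη0)
    _ ≤ C ^ 4 := hle

end Cases

/-! ### The explicit time bound. -/

/-- A bound for the first time at which the orbit of a vector under an integer matrix meets a line:
`d` is the dimension, `B` bounds the data, and `F` the degree of a splitting field. -/
def orbitBound (d B F : ℕ) : ℕ :=
  d + 13 + (2 * B ^ 2) ^ F * B ^ 2 * ((((2 * B) ^ (d + 1)) ^ 2) * (((2 * B) ^ (d + 1)) ^ 2) ^ F) ^ 2
    + 2 * B * ((((2 * B) ^ (d + 1)) ^ 2) * (((2 * B) ^ (d + 1)) ^ 2) ^ F) + ((2 * B) ^ (d + 1)) ^ 4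

lemma orbitBound_mono {d d' B B' F F' : ℕ} (hB : 1 ≤ B) (hd : d ≤ d') (hB' : B ≤ B')
    (hF : F ≤ F') : orbitBound d B F ≤ orbitBound d' B' F' := by
  have hB0 : 0 < B' := by omega
  have h1 : (2 * B) ^ (d + 1) ≤ (2 * B') ^ (d' + 1) :=
    (Nat.pow_le_pow_left (by omega) _).trans (Nat.pow_le_pow_right (by omega) (by omega))
  have h2 : (2 * B ^ 2) ^ F ≤ (2 * B' ^ 2) ^ F' :=
    (Nat.pow_le_pow_left (by gcongr) _).trans (Nat.pow_le_pow_right (by positivity) hF)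
  have h3 : (((2 * B) ^ (d + 1)) ^ 2) ^ F ≤ (((2 * B') ^ (d' + 1)) ^ 2) ^ F' :=
    (Nat.pow_le_pow_left (by gcongr) _).trans (Nat.pow_le_pow_right (by positivity) hF)
  unfold orbitBound
  gcongr

/-- The five polynomials `X ^ 2 - p * X + 1` have as roots only roots of unity of order 1, 2, 3, 4
or 6. -/
lemma pow_twelve_eq_one_of_trace {F : Type*} [Field F] {g : F} (hg : g ≠ 0) {p : ℤ}
    (hp : |p| ≤ 2) (h : g + g⁻¹ = p) : g ^ 12 = 1 := by
  have h2 : g ^ 2 = p * g - 1 := by rw [← h]; field_simp; ring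
  obtain ⟨hp1, hp2⟩ := abs_le.1 hp
  interval_cases p
  · have : g = -1 := by
      have h3 : (g + 1) ^ 2 = 0 := by push_cast at h2; linear_combination h2
      exact eq_neg_of_add_eq_zero_left (pow_eq_zero_iff two_ne_zero |>.1 h3)
    rw [this]; ring
  · have : g ^ 3 = 1 := by push_cast at h2; linear_combination (g - 1) * h2
    rw [show g ^ 12 = (g ^ 3) ^ 4 by ring, this]; ring
  · have : g ^ 2 = -1 := by push_cast at h2; linear_combination h2
    rw [show g ^ 12 = (g ^ 2) ^ 6 by ring, this]; ring
  · have : g ^ 3 = -1 := by push_cast at h2; linear_combination (g + 1) * h2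
    rw [show g ^ 12 = (g ^ 3) ^ 4 by ring, this]; ring
  · have : g = 1 := by
      have h3 : (g - 1) ^ 2 = 0 := by push_cast at h2; linear_combination h2
      exact sub_eq_zero.1 (pow_eq_zero_iff two_ne_zero |>.1 h3)
    rw [this]; ring

/-! ### Galois action on minimal annihilators. -/

namespace Matrix
variable {d : ℕ}

lemma map_rootProd_mulVec {K : Type*} [Field K] (A : Matrix (Fin d) (Fin d) ℤ) (x : Fin d → ℤ)
    (σ : K →+* K) (s : Multiset K) :
    (fun i => σ (((A.map (Int.cast : ℤ → K)).rootProd s *ᵥ (fun i => (x i : K))) i))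
      = (A.map (Int.cast : ℤ → K)).rootProd (s.map σ) *ᵥ (fun i => (x i : K)) := by
  induction s using Multiset.induction with
  | empty => ext i; simp
  | cons r s ih =>
    rw [Multiset.map_cons, rootProd_cons, rootProd_cons, ← mulVec_mulVec, ← mulVec_mulVec, ← ih,
      sub_mulVec, sub_mulVec, smul_mulVec, smul_mulVec, one_mulVec, one_mulVec]
    ext i
    simp only [Pi.sub_apply, Pi.smul_apply, smul_eq_mul, map_sub, map_mul]
    simp only [mulVec, dotProduct, map_sum, map_mul, map_apply, map_intCast]

/-- Galois conjugates of the roots in a minimal annihilating multiset belong to it. -/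
lemma map_mem_of_rootProd_mulVec_eq_zero {K : Type*} [Field K] [DecidableEq K]
    (A : Matrix (Fin d) (Fin d) ℤ)
    (x : Fin d → ℤ) (σ : K →+* K) {s : Multiset K}
    (hs : (A.map (Int.cast : ℤ → K)).rootProd s *ᵥ (fun i => (x i : K)) = 0) {r : K} (hr : r ∈ s)
    (hr0 : (A.map (Int.cast : ℤ → K)).rootProd (s.erase r) *ᵥ (fun i => (x i : K)) ≠ 0) :
    σ r ∈ s := by
  set w := (A.map (Int.cast : ℤ → K)).rootProd (s.erase r) *ᵥ (fun i => (x i : K)) with hw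
  have hAw := rootProd_erase_eigen hr hs
  rw [← hw] at hAw
  have hσw : (A.map (Int.cast : ℤ → K)) *ᵥ (fun i => σ (w i)) = σ r • (fun i => σ (w i)) := by
    ext i
    have := congrArg σ (congrFun hAw i)
    simpa [mulVec, dotProduct] using this
  -- On the eigenvector `σ w` the product over `s` acts as the scalar `∏ (σ r - b)`. It also kills
  -- `σ w`, which is itself a product of linear factors applied to `x`; so some `σ r - b` vanishes.
  have h1 := rootProd_mulVec_of_eigen hσw s
  rw [hw, map_rootProd_mulVec, rootProd_mulVec_comm, hs, mulVec_zero, ← map_rootProd_mulVec, ← hw]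
    at h1
  obtain ⟨i, hi⟩ := Function.ne_iff.1 hr0
  have h2 : (s.map (σ r - ·)).prod = 0 := by
    have := congrFun h1 i
    simp only [Pi.zero_apply, Pi.smul_apply, smul_eq_mul] at this
    exact (mul_eq_zero.1 this.symm).resolve_right ((map_ne_zero σ).2 hi)
  rw [Multiset.prod_eq_zero_iff, Multiset.mem_map] at h2
  obtain ⟨b, hb, hb0⟩ := h2
  rwa [sub_eq_zero.1 hb0]

/-- On the orbit of a vector killed by two coprime linear factors, equality of the `p`-th powers of
the eigenvalues makes the `p`-th power of the matrix scalar. -/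
lemma pow_mulVec_eq_smul_of_pow_eq {K : Type*} [Field K] {A : Matrix (Fin d) (Fin d) K}
    {y : Fin d → K} {r t : K} (hrt : r ≠ t)
    (hr : A *ᵥ (A *ᵥ y - t • y) = r • (A *ᵥ y - t • y))
    (ht : A *ᵥ (A *ᵥ y - r • y) = t • (A *ᵥ y - r • y)) {p : ℕ} (hp : r ^ p = t ^ p) :
    A ^ p *ᵥ y = r ^ p • y := by
  have h1 := pow_mulVec_of_eigen hr p
  have h2 := pow_mulVec_of_eigen ht p
  rw [← hp] at h2
  have h3 : (A *ᵥ y - t • y) - (A *ᵥ y - r • y) = (r - t) • y := by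
    rw [sub_smul]; abel
  have h4 : A ^ p *ᵥ ((r - t) • y) = r ^ p • ((r - t) • y) := by
    rw [← h3, mulVec_sub, h1, h2, ← smul_sub]
  rw [mulVec_smul, smul_comm (r ^ p)] at h4
  exact smul_right_injective _ (sub_ne_zero.2 hrt) h4

end Matrix

/-! ### The case analysis over the splitting field. -/

section Main
variable {K : Type*} [Field K] [NumberField K] [IsGalois ℚ K] {d : ℕ}

lemma exists_rat_trace {r t : K} (hrt : r ≠ t)
    (h : ∀ σ : Gal(K/ℚ), (σ r = r ∨ σ r = t) ∧ (σ t = r ∨ σ t = t)) :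
    ∃ (p : ℤ) (q : ℕ), q ≠ 0 ∧ IsCoprime p (q : ℤ) ∧ r / t + t / r = p / q := by
  obtain ⟨T, hT⟩ := (IsGalois.mem_range_algebraMap_iff_fixed (F := ℚ) (r / t + t / r)).2 (by
    intro σ
    obtain ⟨h1, h2⟩ := h σ
    rw [map_add, map_div₀, map_div₀]
    rcases h1 with h1 | h1 <;> rcases h2 with h2 | h2
    · exact absurd (σ.injective (h1.trans h2.symm)) hrt
    · rw [h1, h2]
    · rw [h1, h2, add_comm]
    · exact absurd (σ.injective (h1.trans h2.symm)) hrt)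
  refine ⟨T.num, T.den, T.den_nz, ?_, ?_⟩
  · rw [Int.isCoprime_iff_gcd_eq_one]
    exact T.reduced
  · rw [← hT, eq_ratCast]
    exact (Rat.cast_def T)

/-- The four summands of `orbitBound` match the cases: `d + 13` covers a preperiod at most `d` and a
period at most 12, then come different moduli, a Jordan block and a nonintegral trace. Only in the
periodic case can `m` differ from `n`. -/
theorem Matrix.exists_le_orbitBound {A : Matrix (Fin d) (Fin d) ℤ} {x u : Fin d → ℤ} {B : ℕ}
    (hB : 1 ≤ B) (hA : ∀ i, ∑ j, |A i j| ≤ B) (hx : ∀ i, |x i| ≤ B) (hu : ∀ i, |u i| ≤ B)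
    (hsp : (A.map (Int.cast : ℤ → K)).charpoly.Splits) {F : ℕ} (hF : Module.finrank ℚ K ≤ F)
    (hmod : ∀ z w : ℂ, (∃ v, v ≠ 0 ∧ A.map (Int.cast : ℤ → ℂ) *ᵥ v = z • v) →
      (∃ v, v ≠ 0 ∧ A.map (Int.cast : ℤ → ℂ) *ᵥ v = w • v) → ‖z‖ = ‖w‖ →
      w = z ∨ w = starRingEnd ℂ z)
    {n : ℕ} {c : K} (hc : c ≠ 0)
    (h : (A.map (Int.cast : ℤ → K)) ^ n *ᵥ (fun i => (x i : K)) = c • fun i => (u i : K)) :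
    ∃ m ≤ orbitBound d B F, ∃ a : K, a ≠ 0 ∧
      (A.map (Int.cast : ℤ → K)) ^ n *ᵥ (fun i => (x i : K)) =
        a • ((A.map (Int.cast : ℤ → K)) ^ m *ᵥ (fun i => (x i : K))) := by
  classical
  have hsmall : n ≤ orbitBound d B F → ∃ m ≤ orbitBound d B F, ∃ a : K, a ≠ 0 ∧
      (A.map (Int.cast : ℤ → K)) ^ n *ᵥ (fun i => (x i : K)) =
        a • ((A.map (Int.cast : ℤ → K)) ^ m *ᵥ (fun i => (x i : K))) :=
    fun hn => ⟨n, hn, 1, one_ne_zero, by simp⟩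
  obtain ⟨φ⟩ : Nonempty (K →+* ℂ) := inferInstance
  obtain ⟨s, hsle, hs0, hsmin⟩ := exists_minimal_rootProd_mulVec_eq_zero hsp (fun i => (x i : K))
  have hcard : s.card ≤ d := by
    refine (Multiset.card_le_card hsle).trans ((card_roots' _).trans ?_)
    rw [charpoly_natDegree_eq_dim, Fintype.card_fin]
  have hroots : ∀ r ∈ s, r ∈ (A.map (Int.cast : ℤ → K)).charpoly.roots :=
    fun r hr => Multiset.mem_of_le hsle hr
  have hBR : (1 : ℝ) ≤ B := by exact_mod_cast hB
  set C : ℝ := (2 * B) ^ (d + 1) with hCdef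
  have hC : 1 ≤ C := one_le_pow₀ (by linarith)
  have hbd : ∀ {v : Fin d → ℤ}, (∀ i, |v i| ≤ B) → ∀ {t : Multiset K}, t ≤ s → ∀ i,
      IsHouseBounded C (((A.map (Int.cast : ℤ → K)).rootProd t *ᵥ (fun i => (v i : K))) i) := by
    intro v hv t hts i
    refine (isHouseBounded_rootProd_mulVec hA hv
      (fun r hr => hroots r (Multiset.mem_of_le hts hr)) i).mono ?_
    have h1 := (Multiset.card_le_card hts).trans hcard
    calc (2 * B : ℝ) ^ t.card * B ≤ (2 * B) ^ d * (2 * B) := by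
          gcongr
          · linarith
          · linarith
      _ = C := (pow_succ _ _).symm
  have happ : ∀ t : Multiset K, (A.map (Int.cast : ℤ → K)) ^ n *ᵥ
      ((A.map (Int.cast : ℤ → K)).rootProd t *ᵥ (fun i => (x i : K)))
      = c • ((A.map (Int.cast : ℤ → K)).rootProd t *ᵥ fun i => (u i : K)) := by
    intro t
    rw [← rootProd_mulVec_pow_mulVec, h, mulVec_smul]
  have heig : ∀ r ∈ s, ∀ i,
      r ^ n * ((A.map (Int.cast : ℤ → K)).rootProd (s.erase r) *ᵥ (fun i => (x i : K))) i
      = c * ((A.map (Int.cast : ℤ → K)).rootProd (s.erase r) *ᵥ (fun i => (u i : K))) i := by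
    intro r hr i
    have := happ (s.erase r)
    rw [pow_mulVec_of_eigen (rootProd_erase_eigen hr hs0)] at this
    exact congrFun this i
  have hnorm : ∀ r ∈ s, ‖φ r‖ ≤ B := fun r hr =>
    (isHouseBounded_of_mem_roots hA (hroots r hr)).norm_le φ
  by_cases h1 : ∃ r ∈ s, ∃ t ∈ s, t ≠ 0 ∧ ‖φ t‖ < ‖φ r‖
  · obtain ⟨r, hr, t, ht, ht0, hlt⟩ := h1
    obtain ⟨i, hi⟩ := Function.ne_iff.1 (hsmin r hr)
    obtain ⟨j, hj⟩ := Function.ne_iff.1 (hsmin t ht)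
    refine hsmall ?_
    have := le_of_norm_lt_norm hC φ hF (hbd hx (s.erase_le r) i) (hbd hu (s.erase_le r) i)
      (hbd hx (s.erase_le t) j) (hbd hu (s.erase_le t) j) hi hj ht0 hc (heig r hr i) (heig t ht j)
      (hnorm t ht) (by positivity)
      (one_le_norm_sq_sub_norm_sq_mul hB hA hsp φ hF (hroots r hr) (hroots t ht) hlt)
    have h2 : n ≤ (2 * B ^ 2) ^ F * B ^ 2 *
      ((((2 * B) ^ (d + 1)) ^ 2) * (((2 * B) ^ (d + 1)) ^ 2) ^ F) ^ 2 := by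
      rw [hCdef] at this
      exact_mod_cast this
    unfold orbitBound
    omega
  by_cases h2 : ∃ r ∈ s, r ≠ 0 ∧ r ∈ s.erase r
  · obtain ⟨r, hr, hr0, hr2⟩ := h2
    obtain ⟨i, hi⟩ := Function.ne_iff.1 (hsmin r hr)
    refine hsmall ?_
    have hle : (s.erase r).erase r ≤ s := ((s.erase r).erase_le r).trans (s.erase_le r)
    have hw := rootProd_erase_eigen hr hs0
    have hJ : ∀ m : ℕ, r • ((A.map (Int.cast : ℤ → K)) ^ m *ᵥ
        ((A.map (Int.cast : ℤ → K)).rootProd ((s.erase r).erase r) *ᵥ (fun i => (x i : K))))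
        = r ^ m • (r • ((A.map (Int.cast : ℤ → K)).rootProd ((s.erase r).erase r) *ᵥ
          (fun i => (x i : K))) + (m : K) • ((A.map (Int.cast : ℤ → K)).rootProd (s.erase r) *ᵥ
          (fun i => (x i : K)))) := by
      have hy : (A.map (Int.cast : ℤ → K)).rootProd (s.erase r) *ᵥ (fun i => (x i : K)) =
          (A.map (Int.cast : ℤ → K)) *ᵥ ((A.map (Int.cast : ℤ → K)).rootProd
            ((s.erase r).erase r) *ᵥ (fun i => (x i : K))) - r •
          ((A.map (Int.cast : ℤ → K)).rootProd ((s.erase r).erase r) *ᵥ (fun i => (x i : K))) := by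
        rw [← Multiset.cons_erase hr2, rootProd_cons, ← mulVec_mulVec, sub_mulVec, smul_mulVec,
          one_mulVec, Multiset.erase_cons_head]
      generalize (A.map (Int.cast : ℤ → K)).rootProd ((s.erase r).erase r) *ᵥ
        (fun i => (x i : K)) = y at *
      generalize (A.map (Int.cast : ℤ → K)).rootProd (s.erase r) *ᵥ
        (fun i => (x i : K)) = w at *
      have hy' := (sub_eq_iff_eq_add.1 hy.symm)
      intro m
      induction m with
      | zero => simp
      | succ m ih =>
        rw [pow_succ', ← mulVec_mulVec, ← mulVec_smul, ih, mulVec_smul, mulVec_add, mulVec_smul,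
          mulVec_smul, hy', hw]
        ext j
        simp only [Pi.smul_apply, Pi.add_apply, smul_eq_mul]
        push_cast
        ring
    have hJi := congrFun (hJ n) i
    rw [happ] at hJi
    have := le_of_jordan_block hC φ hF (hbd hx hle i) (hbd hu hle i) (hbd hx (s.erase_le r) i)
      (hbd hu (s.erase_le r) i) hi hr0 (heig r hr i) hJi.symm (hnorm r hr)
    have h3 : n ≤ 2 * B * ((((2 * B) ^ (d + 1)) ^ 2) * (((2 * B) ^ (d + 1)) ^ 2) ^ F) := by
      rw [hCdef] at this
      exact_mod_cast this
    unfold orbitBound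
    omega
  -- From here on the nonzero elements of `s` are simple and of equal modulus under `φ`.
  push Not at h1 h2
  have hper : ∀ {k p : ℕ} {ρ : K}, k ≤ d → 0 < p → p ≤ 12 → ρ ≠ 0 →
      (A.map (Int.cast : ℤ → K)) ^ p *ᵥ ((A.map (Int.cast : ℤ → K)) ^ k *ᵥ fun i => (x i : K))
        = ρ • ((A.map (Int.cast : ℤ → K)) ^ k *ᵥ fun i => (x i : K)) →
      ∃ m ≤ orbitBound d B F, ∃ a : K, a ≠ 0 ∧
      (A.map (Int.cast : ℤ → K)) ^ n *ᵥ (fun i => (x i : K)) =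
        a • ((A.map (Int.cast : ℤ → K)) ^ m *ᵥ (fun i => (x i : K))) := by
    intro k p ρ hk hp hp' hρ hkp
    obtain ⟨m, hm, hm'⟩ := exists_lt_pow_mulVec_eq_smul hp hρ hkp n
    refine ⟨m, ?_, hm'⟩
    unfold orbitBound
    omega
  by_cases h3 : ∃ r ∈ s, r ≠ 0
  swap
  -- Only the root 0 occurs, so `A ^ k x = 0` for `k = s.card`.
  · push Not at h3
    have hk := Multiset.eq_replicate_card.2 h3
    rw [hk, rootProd_replicate_zero] at hs0
    exact hper hcard one_pos (by norm_num) one_ne_zero (by rw [hs0, mulVec_zero, smul_zero])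
  obtain ⟨r, hr, hr0⟩ := h3
  have hcardr : (s.erase r).card ≤ d := (Multiset.card_le_card (s.erase_le r)).trans hcard
  have hw := rootProd_erase_eigen hr hs0
  by_cases h4 : ∃ t ∈ s, t ≠ 0 ∧ t ≠ r
  swap
  -- With a single nonzero root `r`, simple in `s`, a power `A ^ k x` is an eigenvector for `r`.
  · push Not at h4
    have hk : s.erase r = Multiset.replicate (s.erase r).card 0 := by
      refine Multiset.eq_replicate_card.2 fun b hb => ?_
      by_contra hb0
      rw [h4 b (Multiset.mem_of_mem_erase hb) hb0] at hb
      exact h2 r hr hr0 hb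
    rw [hk, rootProd_replicate_zero] at hw
    exact hper hcardr one_pos (by norm_num) hr0 (by rw [pow_one, hw])
  obtain ⟨t, ht, ht0, htr⟩ := h4
  have hw' := rootProd_erase_eigen ht hs0
  have hev : ∀ b ∈ s, ∃ v, v ≠ 0 ∧ A.map (Int.cast : ℤ → ℂ) *ᵥ v = φ b • v := by
    intro b hb
    refine ⟨fun i => φ (((A.map (Int.cast : ℤ → K)).rootProd (s.erase b) *ᵥ
      (fun i => (x i : K))) i), ?_, ?_⟩
    · obtain ⟨i, hi⟩ := Function.ne_iff.1 (hsmin b hb)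
      exact Function.ne_iff.2 ⟨i, (map_ne_zero φ).2 hi⟩
    · ext i
      have := congrArg φ (congrFun (rootProd_erase_eigen hb hs0) i)
      rw [mulVec, dotProduct, map_sum] at this
      simpa only [mulVec, dotProduct, map_apply, map_mul, map_intCast, Pi.smul_apply,
        smul_eq_mul] using this
  have hnormeq : ∀ b ∈ s, b ≠ 0 → ‖φ r‖ = ‖φ b‖ := fun b hb hb0 =>
    le_antisymm (h1 r hr b hb hb0) (h1 b hb r hr hr0)
  have hconj : ∀ b ∈ s, b ≠ 0 → b ≠ r → φ b = starRingEnd ℂ (φ r) := fun b hb hb0 hbr =>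
    (hmod _ _ (hev r hr) (hev b hb) (hnormeq b hb hb0)).resolve_left fun e => hbr (φ.injective e)
  have hpair : ∀ b ∈ s, b ≠ 0 → b = r ∨ b = t := by
    intro b hb hb0
    by_cases hbr : b = r
    · exact Or.inl hbr
    · exact Or.inr (φ.injective ((hconj b hb hb0 hbr).trans (hconj t ht ht0 htr).symm))
  have htr' : t ∈ s.erase r := (Multiset.mem_erase_of_ne htr).2 ht
  obtain ⟨k, hk, hkcard⟩ : ∃ k : ℕ, s = r ::ₘ t ::ₘ Multiset.replicate k 0 ∧ k ≤ d := by
    refine ⟨((s.erase r).erase t).card, ?_, (Multiset.card_le_card (Multiset.erase_le _ _)).trans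
      hcardr⟩
    have : (s.erase r).erase t = Multiset.replicate ((s.erase r).erase t).card 0 := by
      refine Multiset.eq_replicate_card.2 fun b hb => ?_
      by_contra hb0
      have hbs := Multiset.mem_of_mem_erase hb
      rcases hpair b (Multiset.mem_of_mem_erase hbs) hb0 with rfl | rfl
      · exact h2 b hr hr0 hbs
      · refine h2 b ht ht0 (Multiset.mem_of_le ?_ hb)
        rw [Multiset.erase_comm]
        exact Multiset.erase_le _ _
    rw [← this, Multiset.cons_erase htr', Multiset.cons_erase hr]
  have hprod : ∀ b : K, (A.map (Int.cast : ℤ → K)).rootProd (b ::ₘ Multiset.replicate k 0) *ᵥ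
      (fun i => (x i : K)) = (A.map (Int.cast : ℤ → K)) *ᵥ ((A.map (Int.cast : ℤ → K)) ^ k *ᵥ
        fun i => (x i : K)) - b • ((A.map (Int.cast : ℤ → K)) ^ k *ᵥ fun i => (x i : K)) := by
    intro b
    rw [rootProd_cons, rootProd_replicate_zero, ← mulVec_mulVec, sub_mulVec, smul_mulVec,
      one_mulVec]
  have her : s.erase r = t ::ₘ Multiset.replicate k 0 := by rw [hk, Multiset.erase_cons_head]
  have het : s.erase t = r ::ₘ Multiset.replicate k 0 := by
    rw [hk, Multiset.cons_swap, Multiset.erase_cons_head]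
  rw [her, hprod] at hw
  rw [het, hprod] at hw'
  have hgal : ∀ σ : Gal(K/ℚ), ∀ b ∈ s, b ≠ 0 → σ b = r ∨ σ b = t := fun σ b hb hb0 =>
    hpair _ (map_mem_of_rootProd_mulVec_eq_zero A x (σ : K →+* K) hs0 hb (hsmin b hb))
      ((map_ne_zero σ).2 hb0)
  obtain ⟨p, q, hq0, hpq, htrace⟩ := exists_rat_trace htr.symm
    fun σ => ⟨hgal σ r hr hr0, hgal σ t ht ht0⟩
  rcases (show q = 1 ∨ 2 ≤ q by omega) with rfl | hq2
  · have hp : |p| ≤ 2 := by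
      have e1 : ‖φ (r / t + t / r)‖ ≤ 2 := by
        have hne : ‖φ r‖ ≠ 0 := norm_ne_zero_iff.2 ((map_ne_zero φ).2 hr0)
        rw [map_add, map_div₀, map_div₀]
        refine (norm_add_le _ _).trans ?_
        rw [norm_div, norm_div, ← hnormeq t ht ht0, div_self hne]
        norm_num
      rw [htrace, Nat.cast_one, div_one, map_intCast, Complex.norm_intCast] at e1
      exact_mod_cast e1
    have hg := pow_twelve_eq_one_of_trace (g := r / t) (div_ne_zero hr0 ht0) hp
      (by rw [inv_div, htrace]; simp)
    rw [div_pow, div_eq_one_iff_eq (pow_ne_zero _ ht0)] at hg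
    exact hper hkcard (by norm_num) le_rfl (pow_ne_zero 12 hr0)
      (pow_mulVec_eq_smul_of_pow_eq htr.symm hw hw' hg)
  · obtain ⟨i, hi⟩ := Function.ne_iff.1 (hsmin r hr)
    obtain ⟨j, hj⟩ := Function.ne_iff.1 (hsmin t ht)
    refine hsmall ?_
    have := le_of_nonintegral_trace hC (hbd hx (s.erase_le r) i) (hbd hu (s.erase_le r) i)
      (hbd hx (s.erase_le t) j) (hbd hu (s.erase_le t) j) hi hj hr0 ht0 hc (heig r hr i)
      (heig t ht j) hq2 hpq htrace
    have h5 : n ≤ ((2 * B) ^ (d + 1)) ^ 4 := by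
      rw [hCdef] at this
      exact_mod_cast this
    unfold orbitBound
    omega

end Main

/-! ### Descent from the splitting field to integer data. -/

lemma Polynomial.finrank_splittingField_le_factorial (p : ℚ[X]) :
    Module.finrank ℚ p.SplittingField ≤ p.natDegree.factorial := by
  classical
  have : Fact ((p.map (algebraMap ℚ p.SplittingField)).Splits) := ⟨SplittingField.splits p⟩
  have : IsSplittingField ℚ p.SplittingField p := IsSplittingField.splittingField p
  have : Normal ℚ p.SplittingField := Normal.of_isSplittingField p
  have : IsGalois ℚ p.SplittingField := ⟨⟩
  rw [← IsGalois.card_aut_eq_finrank ℚ p.SplittingField]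
  calc Nat.card (p.SplittingField ≃ₐ[ℚ] p.SplittingField)
      ≤ Nat.card (Equiv.Perm (p.rootSet p.SplittingField)) :=
        Nat.card_le_card_of_injective _ (Gal.galActionHom_injective p p.SplittingField)
    _ = (p.rootSet p.SplittingField).ncard.factorial := Nat.card_perm
    _ ≤ p.natDegree.factorial := Nat.factorial_le (ncard_rootSet_le p _)

namespace Matrix
variable {d : ℕ}

lemma pow_mulVec_eq_zero_of_pow_mulVec_eq_zero {F : Type*} [Field F]
    (A : Matrix (Fin d) (Fin d) F) {v : Fin d → F} {n : ℕ} (h : A ^ n *ᵥ v = 0) :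
    A ^ d *ᵥ v = 0 := by
  have h1 := Module.End.ker_pow_le_ker_pow_finrank (toLin' A) n
  rw [Module.finrank_fin_fun, ← toLin'_pow, ← toLin'_pow] at h1
  exact h1 (x := v) h

lemma map_intCast_pow_mulVec {R : Type*} [CommRing R] (A : Matrix (Fin d) (Fin d) ℤ)
    (x : Fin d → ℤ) (n : ℕ) : (A.map (Int.cast : ℤ → R)) ^ n *ᵥ (fun i => (x i : R)) =
      fun i => (((A ^ n *ᵥ x) i : ℤ) : R) := by
  have h1 : (A.map (Int.cast : ℤ → R)) ^ n = (A ^ n).map (Int.cast : ℤ → R) :=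
    (Matrix.map_pow A (Int.castRingHom R) n).symm
  ext i
  rw [h1]
  simp [mulVec, dotProduct]

theorem exists_le_orbitBound_of_int {A : Matrix (Fin d) (Fin d) ℤ} {x u : Fin d → ℤ} {B : ℕ}
    (hB : 1 ≤ B) (hA : ∀ i, ∑ j, |A i j| ≤ B) (hx : ∀ i, |x i| ≤ B) (hu : ∀ i, |u i| ≤ B)
    (hmod : ∀ z w : ℂ, (∃ v, v ≠ 0 ∧ A.map (Int.cast : ℤ → ℂ) *ᵥ v = z • v) →
      (∃ v, v ≠ 0 ∧ A.map (Int.cast : ℤ → ℂ) *ᵥ v = w • v) → ‖z‖ = ‖w‖ →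
      w = z ∨ w = starRingEnd ℂ z)
    {n : ℕ} {c : ℚ} (hu0 : u ≠ 0) (h : ∀ i, ((A ^ n *ᵥ x) i : ℚ) = c * u i) :
    ∃ m ≤ orbitBound d B d.factorial, ∃ c : ℚ, ∀ i, ((A ^ m *ᵥ x) i : ℚ) = c * u i := by
  rcases eq_or_ne c 0 with rfl | hc
  · refine ⟨d, by unfold orbitBound; omega, 0, fun i => ?_⟩
    have h1 : (A.map (Int.cast : ℤ → ℚ)) ^ n *ᵥ (fun i => (x i : ℚ)) = 0 := by
      rw [map_intCast_pow_mulVec]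
      ext i
      simpa using h i
    have h2 := pow_mulVec_eq_zero_of_pow_mulVec_eq_zero _ h1
    rw [map_intCast_pow_mulVec] at h2
    simpa using congrFun h2 i
  let p : ℚ[X] := (A.map (Int.cast : ℤ → ℚ)).charpoly
  let K := p.SplittingField
  have : NumberField K := { to_charZero := inferInstance, to_finiteDimensional := inferInstance }
  have : IsSplittingField ℚ K p := IsSplittingField.splittingField p
  have : Normal ℚ K := Normal.of_isSplittingField p
  have : IsGalois ℚ K := ⟨⟩
  have hsp : (A.map (Int.cast : ℤ → K)).charpoly.Splits := by
    have e : (A.map (Int.cast : ℤ → K)).charpoly = p.map (algebraMap ℚ K) := by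
      rw [← charpoly_map]; congr 1
    rw [e]; exact SplittingField.splits p
  have hF : Module.finrank ℚ K ≤ d.factorial := by
    refine (finrank_splittingField_le_factorial p).trans (Nat.factorial_le ?_)
    rw [charpoly_natDegree_eq_dim, Fintype.card_fin]
  have hcK : (c : K) ≠ 0 := by exact_mod_cast hc
  have hK : (A.map (Int.cast : ℤ → K)) ^ n *ᵥ (fun i => (x i : K)) =
      (c : K) • fun i => (u i : K) := by
    rw [map_intCast_pow_mulVec]
    ext i
    have := congrArg (Rat.cast : ℚ → K) (h i)
    push_cast at this
    simpa using this
  obtain ⟨m, hm, a, ha, hma⟩ := exists_le_orbitBound hB hA hx hu hsp hF hmod hcK hK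
  refine ⟨m, hm, ?_⟩
  rw [hK, map_intCast_pow_mulVec] at hma
  have hmi : ∀ i, (c : K) * u i = a * ((A ^ m *ᵥ x) i : ℤ) := fun i => congrFun hma i
  obtain ⟨j, hj⟩ := Function.ne_iff.1 hu0
  have hj' : (u j : ℚ) ≠ 0 := by exact_mod_cast hj
  -- The scalar `a` is only known to lie in `K`. A rational one is read off at a coordinate where
  -- `u` is nonzero, since proportionality is a system of integer identities.
  refine ⟨((A ^ m *ᵥ x) j : ℚ) / u j, fun i => ?_⟩
  have h1 : ((A ^ m *ᵥ x) i : K) * u j = ((A ^ m *ᵥ x) j : K) * u i :=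
    mul_left_cancel₀ ha (mul_left_cancel₀ hcK (by
      linear_combination (-(c : K) * u j) * hmi i + (c : K) * u i * hmi j))
  have h2 : ((A ^ m *ᵥ x) i : ℚ) * u j = ((A ^ m *ᵥ x) j : ℚ) * u i := by
    have h3 : (A ^ m *ᵥ x) i * u j = (A ^ m *ᵥ x) j * u i := by
      apply Int.cast_injective (α := K)
      exact (Int.cast_mul _ _).trans (h1.trans (Int.cast_mul _ _).symm)
    exact_mod_cast h3
  field_simp
  exact h2

end Matrix

/-! ### Clearing denominators. -/

lemma exists_common_denominator {ι : Type*} [Fintype ι] {S : ℕ} (q : ι → ℚ)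
    (hnum : ∀ i, (q i).num.natAbs ≤ S) (hden : ∀ i, (q i).den ≤ S) :
    ∃ D : ℕ, D ≠ 0 ∧ ∃ z : ι → ℤ, ∀ i, (z i : ℚ) = D * q i ∧
      |z i| ≤ ((S ^ (Fintype.card ι + 1) : ℕ) : ℤ) := by
  refine ⟨∏ i, (q i).den, Finset.prod_ne_zero_iff.2 fun i _ => (q i).den_nz, fun i =>
    (q i).num * (((∏ i, (q i).den) / (q i).den : ℕ) : ℤ), fun i => ⟨?_, ?_⟩⟩
  · have hdvd : (q i).den ∣ ∏ i, (q i).den := Finset.dvd_prod_of_mem _ (Finset.mem_univ i)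
    have hne : ((q i).den : ℚ) ≠ 0 := by exact_mod_cast (q i).den_nz
    rw [Int.cast_mul, Int.cast_natCast, Nat.cast_div hdvd hne]
    conv_rhs => rw [← Rat.num_div_den (q i)]
    field_simp
  · have h1 : ∏ i, (q i).den ≤ S ^ Fintype.card ι := by
      simpa using Finset.prod_le_pow_card Finset.univ (fun i => (q i).den) S fun i _ => hden i
    have h2 := (Nat.div_le_self (∏ i, (q i).den) (q i).den).trans h1
    rw [Int.abs_eq_natAbs, Int.natAbs_mul, Int.natAbs_natCast, pow_succ']
    exact_mod_cast Nat.mul_le_mul (hnum i) h2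

/-- A bound for the reaching time in terms of a bound `S` for the dimension and for all numerators
and denominators. -/
def reachBound (S : ℕ) : ℕ := orbitBound S (S ^ (S * S + 2)) (S ^ S)

/-- Nonzero rescaling of `A`, `x` and `u` changes neither membership in the line nor the condition
on moduli, as all eigenvalues scale by one positive integer. The splitting field degree is at most
`d!`, hence at most `S ^ S`. -/
theorem Matrix.exists_le_reachBound {d S : ℕ} (hS : 1 ≤ S) (hd : d ≤ S)
    {A : Matrix (Fin d) (Fin d) ℚ} {x u : Fin d → ℚ}
    (hA : ∀ i j, (A i j).num.natAbs ≤ S ∧ (A i j).den ≤ S)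
    (hx : ∀ i, (x i).num.natAbs ≤ S ∧ (x i).den ≤ S)
    (hu : ∀ i, (u i).num.natAbs ≤ S ∧ (u i).den ≤ S)
    (hmod : A.HasDistinctModuli) (hu0 : u ≠ 0) {n : ℕ}
    (h : A ^ n *ᵥ x ∈ Submodule.span ℚ {u}) :
    ∃ m ≤ reachBound S, A ^ m *ᵥ x ∈ Submodule.span ℚ {u} := by
  obtain ⟨D, hD, A', hA'⟩ := exists_common_denominator (fun p : Fin d × Fin d => A p.1 p.2)
    (fun p => (hA p.1 p.2).1) (fun p => (hA p.1 p.2).2)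
  obtain ⟨Dx, hDx, x', hx'⟩ := exists_common_denominator x (fun i => (hx i).1) fun i => (hx i).2
  obtain ⟨Du, hDu, u', hu'⟩ := exists_common_denominator u (fun i => (hu i).1) fun i => (hu i).2
  have hDQ : (D : ℚ) ≠ 0 := by exact_mod_cast hD
  have hDxQ : (Dx : ℚ) ≠ 0 := by exact_mod_cast hDx
  have hDuQ : (Du : ℚ) ≠ 0 := by exact_mod_cast hDu
  set M : Matrix (Fin d) (Fin d) ℤ := Matrix.of fun i j => A' (i, j) with hM
  have hMA : M.map (Int.cast : ℤ → ℚ) = (D : ℚ) • A := by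
    ext i j; simpa [hM] using (hA' (i, j)).1
  have hxx : (fun i => (x' i : ℚ)) = (Dx : ℚ) • x := by ext i; exact (hx' i).1
  have hpow : ∀ m i, (((M ^ m *ᵥ x') i : ℤ) : ℚ) = (D : ℚ) ^ m * Dx * (A ^ m *ᵥ x) i := by
    intro m i
    have := congrFun (map_intCast_pow_mulVec (R := ℚ) M x' m) i
    rw [← this, hMA, hxx, _root_.smul_pow, smul_mulVec, mulVec_smul]
    simp [mul_assoc]
  have hB1 : 1 ≤ S ^ (S * S + 2) := Nat.one_le_pow _ _ hS
  have hle : ∀ {k : ℕ}, k ≤ S * S + 2 → ((S ^ k : ℕ) : ℤ) ≤ ((S ^ (S * S + 2) : ℕ) : ℤ) := by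
    intro k hk
    exact_mod_cast Nat.pow_le_pow_right hS hk
  have hcard : Fintype.card (Fin d × Fin d) ≤ S * S := by
    simpa using Nat.mul_le_mul hd hd
  have hdS : Fintype.card (Fin d) + 1 ≤ S * S + 2 := by
    rw [Fintype.card_fin]; nlinarith
  -- A cleared entry is at most `S ^ (S * S + 1)`; summing a row costs one more factor `S`.
  have hrow : ∀ i, ∑ j, |M i j| ≤ ((S ^ (S * S + 2) : ℕ) : ℤ) := by
    intro i
    have h1 : ∀ j ∈ Finset.univ, |M i j| ≤ ((S ^ (S * S + 1) : ℕ) : ℤ) := fun j _ =>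
      (hA' (i, j)).2.trans (by exact_mod_cast Nat.pow_le_pow_right hS (by omega))
    refine (Finset.sum_le_card_nsmul _ _ _ h1).trans ?_
    rw [Finset.card_univ, Fintype.card_fin, nsmul_eq_mul, pow_succ' S (S * S + 1)]
    exact_mod_cast Nat.mul_le_mul_right _ hd
  have hmod' : ∀ z w : ℂ, (∃ v, v ≠ 0 ∧ M.map (Int.cast : ℤ → ℂ) *ᵥ v = z • v) →
      (∃ v, v ≠ 0 ∧ M.map (Int.cast : ℤ → ℂ) *ᵥ v = w • v) → ‖z‖ = ‖w‖ →
      w = z ∨ w = starRingEnd ℂ z := by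
    have hDC : (D : ℂ) ≠ 0 := by exact_mod_cast hD
    have hMC : M.map (Int.cast : ℤ → ℂ) = (D : ℂ) • A.map (algebraMap ℚ ℂ) := by
      ext i j
      have := congrArg (Rat.cast : ℚ → ℂ) (congrFun (congrFun hMA i) j)
      simpa using this
    have hev : ∀ z : ℂ, (∃ v, v ≠ 0 ∧ M.map (Int.cast : ℤ → ℂ) *ᵥ v = z • v) →
        Module.End.HasEigenvalue (Matrix.toLin' (A.map (algebraMap ℚ ℂ))) (z / D) := by
      rintro z ⟨v, hv0, hv⟩
      refine Module.End.hasEigenvalue_of_hasEigenvector (x := v)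
        ⟨Module.End.mem_eigenspace_iff.2 ?_, hv0⟩
      rw [hMC, smul_mulVec] at hv
      rw [toLin'_apply, div_eq_inv_mul, mul_smul, ← hv, smul_smul, inv_mul_cancel₀ hDC, one_smul]
    intro z w hz hw hzw
    rcases hmod _ _ (hev z hz) (hev w hw) (by rw [norm_div, norm_div, hzw]) with e | e
    · left
      field_simp at e
      exact e
    · right
      rw [map_div₀, Complex.conj_natCast] at e
      field_simp at e
      exact e
  obtain ⟨c, hc⟩ := Submodule.mem_span_singleton.1 h
  obtain ⟨j, hj⟩ := Function.ne_iff.1 hu0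
  have hu'0 : u' ≠ 0 := by
    refine Function.ne_iff.2 ⟨j, fun e => ?_⟩
    have := (hu' j).1
    rw [e] at this
    exact mul_ne_zero hDuQ hj (by simpa using this.symm)
  obtain ⟨m, hm, b, hb⟩ := exists_le_orbitBound_of_int (n := n) (c := (D : ℚ) ^ n * Dx * c / Du) hB1
    hrow (fun i => (hx' i).2.trans (hle hdS)) (fun i => (hu' i).2.trans (hle hdS)) hmod' hu'0
    (fun i => by
      rw [hpow, ← hc, (hu' i).1, Pi.smul_apply, smul_eq_mul]
      field_simp)
  refine ⟨m, hm.trans (orbitBound_mono hB1 hd le_rfl ?_), Submodule.mem_span_singleton.2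
    ⟨b * Du / (D ^ m * Dx), ?_⟩⟩
  · exact (Nat.factorial_le_pow d).trans
      ((Nat.pow_le_pow_left hd d).trans (Nat.pow_le_pow_right hS hd))
  · ext i
    have := hb i
    rw [hpow, (hu' i).1] at this
    rw [Pi.smul_apply, smul_eq_mul]
    field_simp
    linarith

/-! ### Primitive recursive arithmetic of integers and fractions. -/

section Arithmetic

lemma Primrec.nat_pow : Primrec₂ ((· ^ ·) : ℕ → ℕ → ℕ) :=
  Primrec₂.unpaired'.1 Nat.Primrec.pow

lemma PrimrecRel.forall_lt_comp {α : Type*} [Primcodable α] {R : ℕ → α → Prop} (hR : PrimrecRel R)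
    {f : α → ℕ} (hf : Primrec f) : PrimrecPred fun a => ∀ x < f a, R x a :=
  (hR.forall_mem_list.comp (Primrec.list_range.comp hf) Primrec.id).of_eq (by simp)

lemma PrimrecRel.exists_lt_comp {α : Type*} [Primcodable α] {R : ℕ → α → Prop} (hR : PrimrecRel R)
    {f : α → ℕ} (hf : Primrec f) : PrimrecPred fun a => ∃ x < f a, R x a :=
  (hR.exists_mem_list.comp (Primrec.list_range.comp hf) Primrec.id).of_eq (by simp)

lemma primrec_orbitBound {α : Type*} [Primcodable α] {f g h : α → ℕ} (hf : Primrec f)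
    (hg : Primrec g) (hh : Primrec h) : Primrec fun a => orbitBound (f a) (g a) (h a) := by
  have two : Primrec fun _ : α => 2 := Primrec.const 2
  have hC : Primrec fun a => (2 * g a) ^ (f a + 1) :=
    Primrec.nat_pow.comp (Primrec.nat_mul.comp two hg) (Primrec.succ.comp hf)
  have hC2 := Primrec.nat_pow.comp hC two
  have hE := Primrec.nat_mul.comp hC2 (Primrec.nat_pow.comp hC2 hh)
  have hg2 := Primrec.nat_pow.comp hg two
  have hG := Primrec.nat_pow.comp (Primrec.nat_mul.comp two hg2) hh
  exact Primrec.nat_add.comp (Primrec.nat_add.comp (Primrec.nat_add.comp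
    (Primrec.nat_add.comp hf (Primrec.const 13))
    (Primrec.nat_mul.comp (Primrec.nat_mul.comp hG hg2) (Primrec.nat_pow.comp hE two)))
    (Primrec.nat_mul.comp (Primrec.nat_mul.comp two hg) hE))
    (Primrec.nat_pow.comp hC (Primrec.const 4))

lemma primrec_reachBound : Primrec reachBound :=
  primrec_orbitBound Primrec.id
    (Primrec.nat_pow.comp Primrec.id
      (Primrec.nat_add.comp (Primrec.nat_mul.comp Primrec.id Primrec.id) (Primrec.const 2)))
    (Primrec.nat_pow.comp Primrec.id Primrec.id)

/-- The parity of the code carries the sign, so positive and negative parts can be computed from the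
code. -/
lemma Int.encode_natCast (n : ℕ) : Encodable.encode (n : ℤ) = 2 * n := rfl

lemma Int.encode_negSucc (n : ℕ) : Encodable.encode (Int.negSucc n) = 2 * n + 1 := rfl

lemma Int.natAbs_le_encode (z : ℤ) : z.natAbs ≤ Encodable.encode z := by
  rcases z with n | n
  · rw [Int.ofNat_eq_natCast, Int.encode_natCast, Int.natAbs_natCast]; omega
  · rw [Int.encode_negSucc, Int.natAbs_negSucc]; omega

lemma Primrec.int_toNat : Primrec Int.toNat := by
  have h : Primrec fun z : ℤ =>
      if Encodable.encode z % 2 = 0 then Encodable.encode z / 2 else 0 :=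
    Primrec.ite (Primrec.eq.comp (Primrec.nat_mod.comp Primrec.encode (Primrec.const 2))
      (Primrec.const 0)) (Primrec.nat_div.comp Primrec.encode (Primrec.const 2)) (Primrec.const 0)
  refine h.of_eq fun z => ?_
  rcases z with n | n
  · rw [Int.ofNat_eq_natCast, Int.encode_natCast, Int.toNat_natCast, if_pos (by omega)]; omega
  · rw [Int.encode_negSucc, if_neg (by omega)]; rfl

lemma Primrec.int_neg_toNat : Primrec fun z : ℤ => (-z).toNat := by
  have h : Primrec fun z : ℤ =>
      if Encodable.encode z % 2 = 0 then 0 else Encodable.encode z / 2 + 1 :=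
    Primrec.ite (Primrec.eq.comp (Primrec.nat_mod.comp Primrec.encode (Primrec.const 2))
      (Primrec.const 0)) (Primrec.const 0)
      (Primrec.succ.comp (Primrec.nat_div.comp Primrec.encode (Primrec.const 2)))
  refine h.of_eq fun z => ?_
  rcases z with n | n
  · rw [Int.ofNat_eq_natCast, Int.encode_natCast, if_pos (by omega)]; omega
  · rw [Int.encode_negSucc, if_neg (by omega), Int.neg_negSucc]; omega

lemma encode_le_encode_of_mem {α : Type*} [Encodable α] {a : α} {l : List α} (h : a ∈ l) :
    Encodable.encode a ≤ Encodable.encode l := by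
  induction l with
  | nil => simp at h
  | cons b l ih =>
    rw [Encodable.encode_list_cons]
    rcases List.mem_cons.1 h with rfl | h
    · exact (Nat.left_le_pair _ _).trans (Nat.le_succ _)
    · exact (ih h).trans ((Nat.right_le_pair _ _).trans (Nat.le_succ _))

/-- The triple `(a, b, c)` stands for the fraction `(a - b) / c`. -/
abbrev Frac : Type := ℕ × ℕ × ℕ

namespace Frac

/-- A triple represents a rational number. -/
def Rep (a : Frac) (q : ℚ) : Prop := a.2.2 ≠ 0 ∧ (a.1 : ℚ) - a.2.1 = q * a.2.2

/-- The fraction `0 / 1`. -/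
def zero : Frac := (0, 0, 1)

/-- The fraction with given numerator and denominator. -/
def ofPair (p : ℤ × ℕ) : Frac := (p.1.toNat, (-p.1).toNat, p.2)

/-- The sum of two fractions. -/
def add (a b : Frac) : Frac :=
  (a.1 * b.2.2 + b.1 * a.2.2, a.2.1 * b.2.2 + b.2.1 * a.2.2, a.2.2 * b.2.2)

/-- The product of two fractions. -/
def mul (a b : Frac) : Frac :=
  (a.1 * b.1 + a.2.1 * b.2.1, a.1 * b.2.1 + a.2.1 * b.1, a.2.2 * b.2.2)

/-- Equality of the rational numbers represented by two fractions. -/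
def Equal (a b : Frac) : Prop :=
  a.1 * b.2.2 + b.2.1 * a.2.2 = b.1 * a.2.2 + a.2.1 * b.2.2

lemma rep_zero : Rep zero 0 := by simp [Rep, zero]

lemma rep_ofPair (q : ℚ) : Rep (ofPair (OrbitInstance.encodeRat q)) q := by
  refine ⟨q.den_nz, ?_⟩
  have h1 : (q.num.toNat : ℚ) - ((-q.num).toNat : ℚ) = q.num := by
    rw [← Int.cast_natCast, ← Int.cast_natCast (-q.num).toNat, ← Int.cast_sub]
    congr 1
    omega
  have h2 : q * q.den = q.num := Rat.mul_den_eq_num q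
  exact h1.trans h2.symm

variable {a b : Frac} {q r : ℚ}

lemma Rep.add (ha : a.Rep q) (hb : b.Rep r) : (add a b).Rep (q + r) := by
  refine ⟨mul_ne_zero ha.1 hb.1, ?_⟩
  simp only [Frac.add]
  push_cast
  linear_combination (b.2.2 : ℚ) * ha.2 + a.2.2 * hb.2

lemma Rep.mul (ha : a.Rep q) (hb : b.Rep r) : (mul a b).Rep (q * r) := by
  refine ⟨mul_ne_zero ha.1 hb.1, ?_⟩
  simp only [Frac.mul]
  push_cast
  linear_combination ((b.1 : ℚ) - b.2.1) * ha.2 + q * a.2.2 * hb.2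

lemma Rep.equal_iff (ha : a.Rep q) (hb : b.Rep r) : a.Equal b ↔ q = r := by
  have h1 : (a.2.2 : ℚ) ≠ 0 := by exact_mod_cast ha.1
  have h2 : (b.2.2 : ℚ) ≠ 0 := by exact_mod_cast hb.1
  have h3 : a.Equal b ↔
      (a.1 : ℚ) * b.2.2 + b.2.1 * a.2.2 = b.1 * a.2.2 + a.2.1 * b.2.2 := by
    unfold Equal; exact_mod_cast Iff.rfl
  rw [h3]
  constructor
  · intro h
    refine mul_right_cancel₀ (mul_ne_zero h1 h2) ?_
    linear_combination h - (b.2.2 : ℚ) * ha.2 + (a.2.2 : ℚ) * hb.2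
  · rintro rfl
    linear_combination (b.2.2 : ℚ) * ha.2 - (a.2.2 : ℚ) * hb.2

lemma primrec_ofPair : Primrec ofPair :=
  (Primrec.int_toNat.comp .fst).pair ((Primrec.int_neg_toNat.comp .fst).pair .snd)

section
open Primrec
variable {α : Type*} [Primcodable α] {f g : α → Frac}

lemma primrec_add (hf : Primrec f) (hg : Primrec g) : Primrec fun x => add (f x) (g x) := by
  have f1 := fst.comp hf
  have f2 := fst.comp (snd.comp hf)
  have f3 := snd.comp (snd.comp hf)
  have g1 := fst.comp hg
  have g2 := fst.comp (snd.comp hg)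
  have g3 := snd.comp (snd.comp hg)
  exact (nat_add.comp (nat_mul.comp f1 g3) (nat_mul.comp g1 f3)).pair
    ((nat_add.comp (nat_mul.comp f2 g3) (nat_mul.comp g2 f3)).pair (nat_mul.comp f3 g3))

lemma primrec_mul (hf : Primrec f) (hg : Primrec g) : Primrec fun x => mul (f x) (g x) := by
  have f1 := fst.comp hf
  have f2 := fst.comp (snd.comp hf)
  have f3 := snd.comp (snd.comp hf)
  have g1 := fst.comp hg
  have g2 := fst.comp (snd.comp hg)
  have g3 := snd.comp (snd.comp hg)
  exact (nat_add.comp (nat_mul.comp f1 g1) (nat_mul.comp f2 g2)).pair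
    ((nat_add.comp (nat_mul.comp f1 g2) (nat_mul.comp f2 g1)).pair (nat_mul.comp f3 g3))

lemma primrecPred_equal (hf : Primrec f) (hg : Primrec g) :
    PrimrecPred fun x => Equal (f x) (g x) := by
  have f1 := fst.comp hf
  have f2 := fst.comp (snd.comp hf)
  have f3 := snd.comp (snd.comp hf)
  have g1 := fst.comp hg
  have g2 := fst.comp (snd.comp hg)
  have g3 := snd.comp (snd.comp hg)
  exact Primrec.eq.comp (nat_add.comp (nat_mul.comp f1 g3) (nat_mul.comp g2 f3))
    (nat_add.comp (nat_mul.comp g1 f3) (nat_mul.comp f2 g3))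

end
end Frac
end Arithmetic

/-! ### The algorithm: exact orbit computation and bounded search. -/

namespace OrbitInstance

/-- The `j`-th coordinate of a written-down vector. -/
def coord (l : List (ℤ × ℕ)) (j : ℕ) : Frac := (l.map Frac.ofPair).getD j Frac.zero

/-- The product of a written-down row vector and a vector of fractions, of length `d`. -/
def dot (d : ℕ) (row : List (ℤ × ℕ)) (w : List Frac) : Frac :=
  (List.range d).foldl (fun acc j => Frac.add acc (Frac.mul (coord row j) (w.getD j Frac.zero)))
    Frac.zero

/-- Multiplication of a vector by the matrix of the input. -/
def step (I : Input) (w : List Frac) : List Frac :=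
  (List.range I.1).map fun i => dot I.1 (I.2.1.getD i []) w

/-- The `n`-th vector of the orbit. -/
def orbit (I : Input) (n : ℕ) : List Frac := (step I)^[n] (I.2.2.1.map Frac.ofPair)

/-- The `n`-th vector of the orbit lies in the target, provided this is spanned by the first
vector of the list presenting it. -/
def Hits (I : Input) (n : ℕ) : Prop :=
  (I.2.2.2 = [] ∧ ∀ i < I.1, Frac.Equal ((orbit I n).getD i Frac.zero) Frac.zero) ∨
  (I.2.2.2 ≠ [] ∧ ∀ i < I.1, ∀ j < I.1,
    Frac.Equal (Frac.mul ((orbit I n).getD i Frac.zero) (coord (I.2.2.2.headI) j))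
      (Frac.mul ((orbit I n).getD j Frac.zero) (coord (I.2.2.2.headI) i)))

section Primrec
open Primrec
variable {α : Type*} [Primcodable α]

lemma primrec_coord {f : α → List (ℤ × ℕ)} {g : α → ℕ} (hf : Primrec f) (hg : Primrec g) :
    Primrec fun x => coord (f x) (g x) :=
  (list_getD Frac.zero).comp (list_map hf (Frac.primrec_ofPair.comp snd).to₂) hg

lemma primrec_dot {f : α → ℕ} {g : α → List (ℤ × ℕ)} {h : α → List Frac} (hf : Primrec f)
    (hg : Primrec g) (hh : Primrec h) : Primrec fun x => dot (f x) (g x) (h x) := by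
  have hj : Primrec fun p : α × (Frac × ℕ) => p.2.2 := snd.comp snd
  have hbody : Primrec fun p : α × (Frac × ℕ) =>
      Frac.add p.2.1 (Frac.mul (coord (g p.1) p.2.2) ((h p.1).getD p.2.2 Frac.zero)) :=
    Frac.primrec_add (fst.comp snd) (Frac.primrec_mul (primrec_coord (hg.comp fst) hj)
      ((list_getD Frac.zero).comp (hh.comp fst) hj))
  exact list_foldl (list_range.comp hf) (const Frac.zero) hbody.to₂

lemma primrec_step : Primrec₂ step := by
  have hrow : Primrec fun p : (Input × List Frac) × ℕ => p.1.1.2.1.getD p.2 [] :=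
    (list_getD []).comp (fst.comp (snd.comp (fst.comp fst))) snd
  have hdot : Primrec fun p : (Input × List Frac) × ℕ =>
      dot p.1.1.1 (p.1.1.2.1.getD p.2 []) p.1.2 :=
    primrec_dot (fst.comp (fst.comp fst)) hrow (snd.comp fst)
  exact list_map (list_range.comp (fst.comp fst)) hdot.to₂

lemma primrec_orbit : Primrec₂ orbit :=
  nat_iterate snd (list_map (fst.comp (snd.comp (snd.comp fst))) (Frac.primrec_ofPair.comp snd).to₂)
    (primrec_step.comp (fst.comp fst) snd).to₂

lemma primrecRel_hits : PrimrecRel Hits := by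
  have hb : Primrec fun p : Input × ℕ => p.1.2.2.2 := snd.comp (snd.comp (snd.comp fst))
  have hnil : PrimrecPred fun p : Input × ℕ => p.1.2.2.2 = [] := Primrec.eq.comp hb (const [])
  have h1 : PrimrecRel fun (i : ℕ) (p : Input × ℕ) =>
      Frac.Equal ((orbit p.1 p.2).getD i Frac.zero) Frac.zero :=
    Frac.primrecPred_equal ((list_getD Frac.zero).comp
      (primrec_orbit.comp (fst.comp snd) (snd.comp snd)) fst) (const Frac.zero)
  have h2 : PrimrecRel fun (j : ℕ) (p : ℕ × (Input × ℕ)) =>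
      Frac.Equal (Frac.mul ((orbit p.2.1 p.2.2).getD p.1 Frac.zero) (coord (p.2.1.2.2.2.headI) j))
      (Frac.mul ((orbit p.2.1 p.2.2).getD j Frac.zero) (coord (p.2.1.2.2.2.headI) p.1)) := by
    have ho : Primrec fun q : ℕ × (ℕ × (Input × ℕ)) => orbit q.2.2.1 q.2.2.2 :=
      primrec_orbit.comp (fst.comp (snd.comp snd)) (snd.comp (snd.comp snd))
    have hu : Primrec fun q : ℕ × (ℕ × (Input × ℕ)) => q.2.2.1.2.2.2.headI :=
      list_headI.comp (hb.comp (snd.comp snd))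
    have hi : Primrec fun q : ℕ × (ℕ × (Input × ℕ)) => q.2.1 := fst.comp snd
    exact Frac.primrecPred_equal
      (Frac.primrec_mul ((list_getD Frac.zero).comp ho hi) (primrec_coord hu fst))
      (Frac.primrec_mul ((list_getD Frac.zero).comp ho fst) (primrec_coord hu hi))
  have hd : Primrec fun p : Input × ℕ => p.1.1 := fst.comp fst
  have h2' : PrimrecRel fun (i : ℕ) (p : Input × ℕ) => ∀ j < p.1.1,
      Frac.Equal (Frac.mul ((orbit p.1 p.2).getD i Frac.zero) (coord (p.1.2.2.2.headI) j))
      (Frac.mul ((orbit p.1 p.2).getD j Frac.zero) (coord (p.1.2.2.2.headI) i)) :=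
    h2.forall_lt_comp (hd.comp snd)
  exact (hnil.and (h1.forall_lt_comp hd)).or
    (hnil.not.and (h2'.forall_lt_comp hd))

/-- Whether the target is hit within the time bound that the size of the input gives. -/
def HitsInTime (I : Input) : Prop :=
  ∃ n < reachBound (Encodable.encode I + 1) + 1, Hits I n

lemma primrecPred_hitsInTime : PrimrecPred HitsInTime := by
  have h : PrimrecRel fun (n : ℕ) (I : Input) => Hits I n := primrecRel_hits.comp snd fst
  exact h.exists_lt_comp (succ.comp (primrec_reachBound.comp (succ.comp Primrec.encode)))

end Primrec

/-! ### Correctness of the algorithm. -/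

section Correctness
variable (I : OrbitInstance)

lemma rep_coord {d : ℕ} (v : Fin d → ℚ) (j : Fin d) : (coord (encodeVec v) j).Rep (v j) := by
  have : coord (encodeVec v) j = Frac.ofPair (encodeRat (v j)) := by
    simp [coord, encodeVec]
  rw [this]
  exact Frac.rep_ofPair _

lemma rep_foldl {d : ℕ} (f : ℕ → Frac) (g : Fin d → ℚ) (h : ∀ j : Fin d, (f j).Rep (g j)) :
    ((List.range d).foldl (fun acc j => Frac.add acc (f j)) Frac.zero).Rep (∑ j, g j) := by
  induction d with
  | zero => simpa using Frac.rep_zero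
  | succ d ih =>
    rw [List.range_succ, List.foldl_append, Fin.sum_univ_castSucc]
    exact (ih (fun j => g j.castSucc) fun j => h j.castSucc).add (h (Fin.last d))

lemma rep_orbit (n : ℕ) (i : Fin I.d) :
    ((orbit I.encode n).getD i Frac.zero).Rep ((I.A ^ n *ᵥ I.x) i) := by
  induction n generalizing i with
  | zero =>
    rw [pow_zero, one_mulVec]
    exact rep_coord I.x i
  | succ n ih =>
    have e : orbit I.encode (n + 1) = step I.encode (orbit I.encode n) :=
      Function.iterate_succ_apply' _ _ _
    have e' : (step I.encode (orbit I.encode n)).getD i Frac.zero =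
        dot I.d (encodeVec (I.A i)) (orbit I.encode n) := by
      simp [step, encode]
    rw [e, e', pow_succ', ← mulVec_mulVec]
    exact rep_foldl _ (fun j => I.A i j * (I.A ^ n *ᵥ I.x) j)
      fun j => (rep_coord (I.A i) j).mul (ih j)

lemma encode_vec_le {d : ℕ} (v : Fin d → ℚ) (i : Fin d) :
    (v i).num.natAbs ≤ Encodable.encode (encodeVec v) ∧
      (v i).den ≤ Encodable.encode (encodeVec v) := by
  have h : Encodable.encode (encodeRat (v i)) ≤ Encodable.encode (encodeVec v) :=
    encode_le_encode_of_mem (List.mem_ofFn.2 ⟨i, rfl⟩)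
  rw [encodeRat, Encodable.encode_prod_val] at h
  exact ⟨(Int.natAbs_le_encode _).trans ((Nat.left_le_pair _ _).trans h),
    (Nat.right_le_pair _ _).trans h⟩

/-- The code of the input, built by pairing, dominates the dimension and every numerator and
denominator, so it serves as the size `S`; the added 1 ensures `S ≥ 1`. Linear independence leaves
at most one basis vector, and it is nonzero. -/
lemma reaches_iff_hitsInTime (hmod : I.A.HasDistinctModuli)
    (hdim : Module.finrank ℚ I.target ≤ 1) : I.Reaches ↔ HitsInTime I.encode := by
  have hlen : I.basis.length ≤ 1 := by
    have h := finrank_span_eq_card I.linearIndependent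
    rw [Fintype.card_fin] at h
    rw [← h]
    have e : Set.range I.basis.get = {v | v ∈ I.basis} := by
      ext v; simp [List.mem_iff_get]
    rw [e]; exact hdim
  have hS1 : Encodable.encode I.encode =
      Nat.pair I.d (Nat.pair (Encodable.encode (List.ofFn fun i => encodeVec (I.A i)))
        (Nat.pair (Encodable.encode (encodeVec I.x))
          (Encodable.encode (I.basis.map encodeVec)))) := rfl
  set S := Encodable.encode I.encode + 1 with hS
  have hdS : I.d ≤ S := by rw [hS, hS1]; exact (Nat.left_le_pair _ _).trans (Nat.le_succ _)
  have htail := Nat.right_le_pair I.d (Nat.pair (Encodable.encode (List.ofFn fun i =>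
    encodeVec (I.A i))) (Nat.pair (Encodable.encode (encodeVec I.x))
      (Encodable.encode (I.basis.map encodeVec))))
  rw [← hS1] at htail
  have hAS : ∀ i j, (I.A i j).num.natAbs ≤ S ∧ (I.A i j).den ≤ S := by
    intro i j
    have h1 : Encodable.encode (encodeVec (I.A i)) ≤
        Encodable.encode (List.ofFn fun i => encodeVec (I.A i)) :=
      encode_le_encode_of_mem (List.mem_ofFn.2 ⟨i, rfl⟩)
    have h2 := h1.trans ((Nat.left_le_pair _ _).trans (htail.trans (Nat.le_succ _)))
    exact ⟨(encode_vec_le _ j).1.trans h2, (encode_vec_le _ j).2.trans h2⟩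
  have htail' := (Nat.right_le_pair _ _).trans htail
  have hxS : ∀ i, (I.x i).num.natAbs ≤ S ∧ (I.x i).den ≤ S := by
    intro i
    have h2 := (Nat.left_le_pair _ _).trans (htail'.trans (Nat.le_succ _))
    exact ⟨(encode_vec_le _ i).1.trans h2, (encode_vec_le _ i).2.trans h2⟩
  have huS : ∀ u ∈ I.basis, ∀ i, (u i).num.natAbs ≤ S ∧ (u i).den ≤ S := by
    intro u hu i
    have h1 : Encodable.encode (encodeVec u) ≤ Encodable.encode (I.basis.map encodeVec) :=
      encode_le_encode_of_mem (List.mem_map.2 ⟨u, hu, rfl⟩)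
    have h2 := h1.trans ((Nat.right_le_pair _ _).trans (htail'.trans (Nat.le_succ _)))
    exact ⟨(encode_vec_le _ i).1.trans h2, (encode_vec_le _ i).2.trans h2⟩
  have hd : I.encode.1 = I.d := rfl
  have hbs : I.encode.2.2.2 = I.basis.map encodeVec := rfl
  rcases hbasis : I.basis with _ | ⟨u, l⟩
  · have htarget : I.target = ⊥ := by simp [target, hbasis]
    have hhit : ∀ n, Hits I.encode n ↔ I.A ^ n *ᵥ I.x ∈ I.target := by
      intro n
      rw [htarget, Submodule.mem_bot, Hits, hbs, hbasis]
      simp only [List.map_nil, true_and, ne_eq, not_true_eq_false, false_and, or_false]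
      rw [funext_iff]
      exact ⟨fun h i => ((rep_orbit I n i).equal_iff Frac.rep_zero).1 (h i i.2), fun h i hi =>
        ((rep_orbit I n ⟨i, hi⟩).equal_iff Frac.rep_zero).2 (h ⟨i, hi⟩)⟩
    constructor
    · rintro ⟨n, hn⟩
      rw [htarget, Submodule.mem_bot] at hn
      -- For the zero target the time `d` suffices, and it lies within the bound.
      refine ⟨I.d, ?_, (hhit _).2 ?_⟩
      · rw [← hS]
        have : S ≤ reachBound S := by unfold reachBound orbitBound; omega
        omega
      · rw [htarget, Submodule.mem_bot]
        exact pow_mulVec_eq_zero_of_pow_mulVec_eq_zero _ hn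
    · rintro ⟨n, -, hn⟩
      exact ⟨n, (hhit n).1 hn⟩
  · obtain rfl : l = [] := by
      rw [hbasis] at hlen
      exact List.eq_nil_of_length_eq_zero (by simpa using hlen)
    have htarget : I.target = Submodule.span ℚ {u} := by simp [target, hbasis]
    have hu : u ∈ I.basis := by simp [hbasis]
    have hu0 : u ≠ 0 := by
      obtain ⟨k, hk⟩ := List.mem_iff_get.1 hu
      rw [← hk]
      exact I.linearIndependent.ne_zero k
    have hhit : ∀ n, Hits I.encode n ↔ I.A ^ n *ᵥ I.x ∈ I.target := by
      intro n
      rw [htarget, Submodule.mem_span_singleton, Hits, hbs, hbasis]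
      simp only [List.map_cons, List.map_nil, List.cons_ne_nil, false_and, false_or, ne_eq,
        not_false_eq_true, true_and, List.headI_cons]
      -- Since `u ≠ 0`, lying on the line of `u` means that all `2 × 2` minors vanish, which needs
      -- no division.
      have hrep : ∀ i j : Fin I.d, Frac.Equal
          (Frac.mul ((orbit I.encode n).getD i Frac.zero) (coord (encodeVec u) j))
          (Frac.mul ((orbit I.encode n).getD j Frac.zero) (coord (encodeVec u) i)) ↔
          (I.A ^ n *ᵥ I.x) i * u j = (I.A ^ n *ᵥ I.x) j * u i := fun i j =>
        ((rep_orbit I n i).mul (rep_coord u j)).equal_iff ((rep_orbit I n j).mul (rep_coord u i))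
      constructor
      · intro h
        obtain ⟨j, hj⟩ := Function.ne_iff.1 hu0
        refine ⟨(I.A ^ n *ᵥ I.x) j / u j, funext fun i => ?_⟩
        have hj' : u j ≠ 0 := hj
        have := (hrep i j).1 (h i i.2 j j.2)
        rw [Pi.smul_apply, smul_eq_mul]
        field_simp
        rw [mul_comm (u j)]
        exact this.symm
      · rintro ⟨c, hc⟩ i hi j hj
        refine (hrep ⟨i, hi⟩ ⟨j, hj⟩).2 ?_
        rw [← hc]
        simp only [Pi.smul_apply, smul_eq_mul]
        ring
    constructor
    · rintro ⟨n, hn⟩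
      rw [htarget] at hn
      obtain ⟨m, hm, hm'⟩ := exists_le_reachBound (Nat.succ_pos _) hdS hAS hxS (huS u hu) hmod hu0 hn
      exact ⟨m, Nat.lt_succ_of_le hm, (hhit m).2 (htarget ▸ hm')⟩
    · rintro ⟨n, -, hn⟩
      exact ⟨n, (hhit n).1 hn⟩

end Correctness
end OrbitInstance

theorem theorem2 :
    OrbitInstance.DecidableOn
      {I : OrbitInstance | I.A.HasDistinctModuli ∧ Module.finrank ℚ I.target ≤ 1} := by
  obtain ⟨_, h⟩ := OrbitInstance.primrecPred_hitsInTime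
  -- The search is bounded, so the algorithm halts on every input; the class is needed only for
  -- correctness.
  refine ⟨fun I => Part.some (decide (OrbitInstance.HitsInTime I)), h.to_comp, fun I hI =>
    ⟨_, Part.mem_some _, ?_⟩⟩
  rw [decide_eq_true_iff, I.reaches_iff_hitsInTime hI.1 hI.2]
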